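/- Let $\mathrm U(g)$ be the group of unitary $g\times g$ complex matrices. For a partition $\mu$ with at most $g$ parts, let $V_g(\mu)$ be the irreducible complex representation of $\mathrm U(g)$ with highest weight $\mu$, and for a subgroup $H\le \mathrm U(g)$ let $\mathfrak m_\mu(H)$ be the multiplicity of the trivial representation in $V_g(\mu)|_H$, i.e. the dimension of the space of $H$-fixed vectors. Put $$J=\begin{pmatrix}0&1&0\\-1&0&0\\0&0&1\end{pmatrix},\qquad \zeta=\begin{pmatrix}\sqrt{-1}&0&0\\0&\sqrt{-1}&0\\0&0&1\end{pmatrix},$$ let $\mathrm U(1)$ denote $\{\mathrm{diag}(t,t^{-1},1): t\in\mathbb C,\ |t|=1\}\le \mathrm U(3)$, and let $H'_{3,4}=\langle \mathrm U(1),\zeta\rangle$ and $H_{3,4}=\langle \mathrm U(1),J,\zeta\rangle$. For $\epsilon\in\{0,1\}$ and integers $z,b'\ge 0$ define $\kappa_\epsilon,\xi_\epsilon,\beta_\epsilon$ (depending on $z,b'$ modulo $4$) and $\eta_\epsilon,\alpha_\epsilon$ (depending on $z,b'$ modulo $2$) by the following tables, in which rows are indexed by the class $0,1,\dots$ of $z$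 and columns by the class $0,1,\dots$ of $b'$: $$\kappa_0=\begin{pmatrix}3&-2&1&0\\2&-4&2&0\\1&-2&3&0\\0&0&0&0\end{pmatrix},\quad \kappa_1=\begin{pmatrix}-1&2&1&0\\-2&4&-2&0\\1&2&-1&0\\0&0&0&0\end{pmatrix},$$ $$\eta_0=\begin{pmatrix}(2,2)&(0,1)\\(1,2)&(1,1)\end{pmatrix},\quad \eta_1=\begin{pmatrix}(0,0)&(2,1)\\(1,0)&(1,1)\end{pmatrix},$$ $$\xi_0=\begin{pmatrix}8&0&4&0\\6&-3&2&1\\4&-4&4&0\\2&1&2&1\end{pmatrix},\quad \xi_1=\begin{pmatrix}0&6&0&2\\0&5&-4&1\\0&2&-4&2\\0&1&0&1\end{pmatrix},$$ $$\alpha_0=\begin{pmatrix}(1,1)&(-1,0)\\(0,1)&(0,0)\end{pmatrix},\quad \alpha_1=\begin{pmatrix}(-1,-1)&(1,0)\\(0,-1)&(0,0)\end{pmatrix},$$ $$\beta_0=\begin{pmatrix}4&1&2&-1\\3&0&-1&0\\2&-3&0&-1\\1&0&1&0\end{pmatrix},\quad \beta_1=\begin{pmatrix}0&3&-2&1\\1&0&-3&0\\-2&-1&-4&1\\-1&0&-1&0\end{pmatrix}.$$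 Write $(x,y)\cdot(b',z)=xb'+yz$. With $b=b'+\epsilon$ and $a=z+b$, let $\Phi=\{(p,q)\in\mathbb Z^2: a\ge p\ge b\ge q\ge\epsilon\}$ and $$\omega_\epsilon(z,b')=2\,\bigl|\{(p,q)\in\Phi: p-q\equiv p+q\equiv 0 \bmod 4\}\bigr|-\bigl|\{(p,q)\in\Phi: p+q\equiv 0\bmod 4\}\bigr| .$$ (1) For every partition $\lambda'=(a+2k,b+2k,\epsilon+2k)$ with $k\in\mathbb Z_{\ge0}$ and $\epsilon\in\{0,1\}$, writing $z=a-b$ and $b'=b-\epsilon$, we have $$\mathfrak m_{\lambda'}(H'_{3,4})=\frac{(z+1)(b'+1)+\kappa_\epsilon(z,b')}{4},\qquad \mathfrak m_{\lambda'}(H_{3,4})=\frac{b'z+\eta_\epsilon(z,b')\cdot(b',z)+\xi_\epsilon(z,b')}{8}.$$ (2) For all $\epsilon\in\{0,1\}$ and $z,b'\in\mathbb Z_{\ge0}$, $$\omega_\epsilon(z,b')=\frac{\alpha_\epsilon(z,b')\cdot(b',z)+\beta_\epsilon(z,b')}{4}.$$ (3) For every integer $m\ge1$, $$\frac12\left(\prod_{i=1}^m(1+x_i)(1+x_i^2)+\prod_{i=1}^m(1+x_i)(1-x_i^2)\right)=\sum_{\lambda}\omega_\epsilon(z,b')\,S_\lambda(x_1,\dots,x_m),$$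 where $\lambda$ runs over all partitions with at most $m$ parts, each part at most $3$, $S_\lambda(x_1,\dots,x_m)$ is the Schur polynomial, and $z,b',\epsilon$ are determined from the transpose $\lambda'=(a+2k,b+2k,\epsilon+2k)$ of $\lambda$ ($k\in\mathbb Z_{\ge0}$, $\epsilon\in\{0,1\}$) by $z=a-b$ and $b'=b-\epsilon$. -/

import Mathlib

namespace SchurU3

noncomputable section

open MvPolynomial

/-! ### Schur polynomials -/

/-- Semistandard Young tableaux of shape `μ` with entries in `{0, …, m - 1}`. -/
abbrev BoundedSSYT (m : ℕ) (μ : YoungDiagram) : Type :=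
  {T : SemistandardYoungTableau μ // ∀ c ∈ μ.cells, T c.1 c.2 < m}

instance instFiniteBoundedSSYT (m : ℕ) (μ : YoungDiagram) : Finite (BoundedSSYT m μ) := by
  refine Finite.of_injective
    (fun (T : BoundedSSYT m μ) (c : μ.cells) => (⟨T.1 c.1.1 c.1.2, T.2 c.1 c.2⟩ : Fin m)) ?_
  intro T T' h
  apply Subtype.ext
  ext i j
  by_cases hc : (i, j) ∈ μ
  · have := congrFun h ⟨(i, j), (YoungDiagram.mem_cells (i, j)).2 hc⟩
    simpa using congrArg Fin.val this
  · rw [T.1.zeros hc, T'.1.zeros hc]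

instance instFintypeBoundedSSYT (m : ℕ) (μ : YoungDiagram) : Fintype (BoundedSSYT m μ) :=
  Fintype.ofFinite _

/-- The Schur polynomial `S_μ(x₁, …, x_m)`: the generating function of the semistandard tableaux
of shape `μ` with entries in an alphabet of `m` letters. -/
def schur (m : ℕ) (μ : YoungDiagram) : MvPolynomial (Fin m) ℚ :=
  ∑ T : BoundedSSYT m μ, ∏ c : μ.cells, X ⟨T.1 c.1.1 c.1.2, T.2 c.1 c.2⟩

/-- The rectangular partition `(g^m)`: `m` rows of length `g`. -/
def rect (m g : ℕ) : YoungDiagram where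
  cells := Finset.range m ×ˢ Finset.range g
  isLowerSet := by
    rintro ⟨i, j⟩ ⟨i', j'⟩ ⟨h₁, h₂⟩ h
    simp only [Finset.coe_product, Finset.coe_range, Set.mem_prod, Set.mem_Iio] at h ⊢
    exact ⟨lt_of_le_of_lt h₁ h.1, lt_of_le_of_lt h₂ h.2⟩

theorem finite_le (μ : YoungDiagram) : {ν : YoungDiagram | ν ≤ μ}.Finite := by
  refine Set.Finite.of_finite_image (f := YoungDiagram.cells) ?_ ?_
  · refine (Finset.finite_toSet μ.cells.powerset).subset ?_
    rintro _ ⟨ν, hν, rfl⟩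
    exact Finset.mem_coe.2 (Finset.mem_powerset.2 (YoungDiagram.cells_subset_iff.2 hν))
  · intro ν _ ν' _ h
    exact YoungDiagram.ext h

/-- The finite set of all partitions whose diagram is contained in that of `μ`. -/
def partitionsIn (μ : YoungDiagram) : Finset YoungDiagram := (finite_le μ).toFinset

/-! ### The irreducible representation of `U(g)` with highest weight `μ` -/

/-- The unitary group `U(g)`. -/
abbrev U (g : ℕ) : Type := Matrix.unitaryGroup (Fin g) ℂ

/-- The algebra of polynomial functions on the `g × g` matrices `x = (x_{ij})`. -/
abbrev MatPoly (g : ℕ) : Type := MvPolynomial (Fin g × Fin g) ℂ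

/-- The substitution `x ↦ x u` on polynomial functions of a `g × g` matrix `x`. -/
def rightMul (g : ℕ) (u : Matrix (Fin g) (Fin g) ℂ) : MatPoly g →ₐ[ℂ] MatPoly g :=
  aeval fun p => ∑ k : Fin g, C (u k p.2) * X (p.1, k)

theorem rightMul_one (g : ℕ) : rightMul g 1 = AlgHom.id ℂ _ := by
  apply MvPolynomial.algHom_ext
  rintro ⟨i, j⟩
  simp [rightMul, Matrix.one_apply]

theorem rightMul_mul (g : ℕ) (u v : Matrix (Fin g) (Fin g) ℂ) :
    rightMul g (u * v) = (rightMul g u).comp (rightMul g v) := by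
  apply MvPolynomial.algHom_ext
  rintro ⟨i, j⟩
  simp only [rightMul, aeval_X, AlgHom.comp_apply, map_sum, map_mul, Matrix.mul_apply,
    algHom_C, MvPolynomial.algebraMap_eq, Finset.sum_mul, Finset.mul_sum]
  rw [Finset.sum_comm]
  refine Finset.sum_congr rfl fun k _ => Finset.sum_congr rfl fun l _ => ?_
  ring

/-- `U(g)` acts on polynomial functions of a `g × g` matrix by `(u • f)(x) = f(x u)`. -/
def polyRep (g : ℕ) : Representation ℂ (U g) (MatPoly g) where
  toFun u := (rightMul g (u : Matrix (Fin g) (Fin g) ℂ)).toLinearMap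
  map_one' := by
    rw [Submonoid.coe_one, rightMul_one]
    rfl
  map_mul' u v := by
    rw [Submonoid.coe_mul, rightMul_mul]
    rfl

/-- The leading principal minor of size `k` of the generic `g × g` matrix, for `k ≤ g`. -/
def leadingMinor (g k : ℕ) : MatPoly g :=
  (Matrix.of fun i j : {i : Fin g // (i : ℕ) < k} => (X (i.1, j.1) : MatPoly g)).det

/-- For `μ` with at most `g` rows, the product over the columns of `μ` of the leading minors of
size the length of the column. A diagonal matrix `diag(t₁, …, t_g)` multiplies it by
`∏ᵢ tᵢ ^ μᵢ`, and the upper triangular unipotent matrices fix it: it is a highest weight vector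
of weight `μ`. -/
def hwVector (g : ℕ) (μ : YoungDiagram) : MatPoly g :=
  ∏ j ∈ Finset.range (μ.rowLen 0), leadingMinor g (μ.colLen j)

/-- The subrepresentation generated by the highest weight vector of weight `μ`. -/
def irrepSub (g : ℕ) (μ : YoungDiagram) : Subrepresentation (polyRep g) where
  toSubmodule := Submodule.span ℂ (Set.range fun u : U g => polyRep g u (hwVector g μ))
  apply_mem_toSubmodule u v hv := by
    induction hv using Submodule.span_induction with
    | mem x hx =>
      obtain ⟨w, rfl⟩ := hx
      refine Submodule.subset_span ⟨u * w, ?_⟩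
      simp [map_mul]
    | zero => simp
    | add x y _ _ hx hy => rw [map_add]; exact Submodule.add_mem _ hx hy
    | smul c x _ hx => rw [map_smul]; exact Submodule.smul_mem _ c hx

/-- `V_g(μ)`, the irreducible representation of `U(g)` with highest weight `μ`
(a partition with at most `g` parts). -/
def irrep (g : ℕ) (μ : YoungDiagram) :
    Representation ℂ (U g) (irrepSub g μ).toSubmodule :=
  (irrepSub g μ).toRepresentation

/-- The multiplicity of the trivial representation of `H` in the restriction of `V_g(μ)`
to `H ≤ U(g)`, i.e. the dimension of the space of `H`-fixed vectors. -/
def trivMult (g : ℕ) (μ : YoungDiagram) (H : Subgroup (U g)) : ℕ :=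
  Module.finrank ℂ (Representation.invariants ((irrep g μ).comp H.subtype))

/-! ### The subgroups of `U(3)` -/

/-- `diag(t, t⁻¹, 1)` for `t` on the unit circle. -/
def torusElt (t : Circle) : U 3 :=
  ⟨!![(t : ℂ), 0, 0; 0, (t : ℂ)⁻¹, 0; 0, 0, 1], by
    have h : (t : ℂ) ≠ 0 := t.coe_ne_zero
    have h' : (starRingEnd ℂ) (t : ℂ) = (t : ℂ)⁻¹ := by
      rw [← Circle.coe_inv_eq_conj, Circle.coe_inv]
    rw [Matrix.mem_unitaryGroup_iff]
    ext i j
    fin_cases i <;> fin_cases j <;>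
      simp [Matrix.mul_apply, Fin.sum_univ_three, Matrix.star_apply, h, h']⟩

def J3 : U 3 :=
  ⟨!![0, 1, 0; -1, 0, 0; 0, 0, 1], by
    rw [Matrix.mem_unitaryGroup_iff]
    ext i j
    fin_cases i <;> fin_cases j <;>
      simp [Matrix.mul_apply, Fin.sum_univ_three, Matrix.star_apply]⟩

def zeta34 : U 3 :=
  ⟨!![Complex.I, 0, 0; 0, Complex.I, 0; 0, 0, 1], by
    rw [Matrix.mem_unitaryGroup_iff]
    ext i j
    fin_cases i <;> fin_cases j <;>
      simp [Matrix.mul_apply, Fin.sum_univ_three, Matrix.star_apply]⟩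

/-- `H'_{3,4} = ⟨U(1), ζ⟩`. -/
def H34' : Subgroup (U 3) := Subgroup.closure (Set.range torusElt ∪ {zeta34})

/-- `H_{3,4} = ⟨U(1), J, ζ⟩`. -/
def H34 : Subgroup (U 3) := Subgroup.closure (Set.range torusElt ∪ {J3, zeta34})

end

/-! ### The tables

Rows are indexed by the class of `z`, columns by the class of `b'`, and the tables are listed for
`ε = 0` and then `ε = 1`. -/

def kappa (ε : Fin 2) (z b' : ℕ) : ℤ :=
  (![!![3, -2, 1, 0; 2, -4, 2, 0; 1, -2, 3, 0; 0, 0, 0, 0],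
     !![-1, 2, 1, 0; -2, 4, -2, 0; 1, 2, -1, 0; 0, 0, 0, 0]] :
    Fin 2 → Matrix (Fin 4) (Fin 4) ℤ) ε (Fin.ofNat 4 z) (Fin.ofNat 4 b')

def eta (ε : Fin 2) (z b' : ℕ) : ℤ × ℤ :=
  (![!![(2, 2), (0, 1); (1, 2), (1, 1)],
     !![(0, 0), (2, 1); (1, 0), (1, 1)]] :
    Fin 2 → Matrix (Fin 2) (Fin 2) (ℤ × ℤ)) ε (Fin.ofNat 2 z) (Fin.ofNat 2 b')

def xi (ε : Fin 2) (z b' : ℕ) : ℤ :=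
  (![!![8, 0, 4, 0; 6, -3, 2, 1; 4, -4, 4, 0; 2, 1, 2, 1],
     !![0, 6, 0, 2; 0, 5, -4, 1; 0, 2, -4, 2; 0, 1, 0, 1]] :
    Fin 2 → Matrix (Fin 4) (Fin 4) ℤ) ε (Fin.ofNat 4 z) (Fin.ofNat 4 b')

def alpha (ε : Fin 2) (z b' : ℕ) : ℤ × ℤ :=
  (![!![(1, 1), (-1, 0); (0, 1), (0, 0)],
     !![(-1, -1), (1, 0); (0, -1), (0, 0)]] :
    Fin 2 → Matrix (Fin 2) (Fin 2) (ℤ × ℤ)) ε (Fin.ofNat 2 z) (Fin.ofNat 2 b')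

def beta (ε : Fin 2) (z b' : ℕ) : ℤ :=
  (![!![4, 1, 2, -1; 3, 0, -1, 0; 2, -3, 0, -1; 1, 0, 1, 0],
     !![0, 3, -2, 1; 1, 0, -3, 0; -2, -1, -4, 1; -1, 0, -1, 0]] :
    Fin 2 → Matrix (Fin 4) (Fin 4) ℤ) ε (Fin.ofNat 4 z) (Fin.ofNat 4 b')

/-- `(x, y) · (b', z) = x b' + y z`. -/
def dot (v : ℤ × ℤ) (b' z : ℕ) : ℤ := v.1 * b' + v.2 * z

/-! ### The coefficients `ω_ε(z, b')` -/

/-- The pairs `(p, q)` with `a ≥ p ≥ b ≥ q ≥ c`. -/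
def Phi (a b c : ℕ) : Finset (ℕ × ℕ) := Finset.Icc b a ×ˢ Finset.Icc c b

def Phi24 (a b c : ℕ) : Finset (ℕ × ℕ) := (Phi a b c).filter fun x => x.1 + x.2 ≡ 0 [MOD 4]

def Phi44 (a b c : ℕ) : Finset (ℕ × ℕ) :=
  (Phi a b c).filter fun x => x.1 ≡ x.2 [MOD 4] ∧ x.1 + x.2 ≡ 0 [MOD 4]

/-- `ω_ε(z, b') = 2 |Φ^{(4,4)}(a, b, ε)| - |Φ^{(2,4)}(a, b, ε)|` where `b = b' + ε` and
`a = z + b`. -/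
def omega (ε : Fin 2) (z b' : ℕ) : ℤ :=
  2 * ((Phi44 (z + b' + ε) (b' + ε) ε).card : ℤ) - ((Phi24 (z + b' + ε) (b' + ε) ε).card : ℤ)

/-- `ω_ε(z, b')` for the parameters of the transpose `μ' = (a + 2k, b + 2k, ε + 2k)` of `μ`, a
partition with at most three columns: here `z = a - b = μ'₁ - μ'₂`, `b' = b - ε = μ'₂ - μ'₃`, and
`ε` is the parity of `μ'₃`. -/
def omegaOf (μ : YoungDiagram) : ℤ :=
  omega (Fin.ofNat 2 (μ.colLen 2)) (μ.colLen 0 - μ.colLen 1) (μ.colLen 1 - μ.colLen 2)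

end SchurU3

namespace SchurU3

open MvPolynomial

/-! ### Counting the pairs in `Φ` -/

/-! Multiplicities. With rows `z + b + c ≥ b + c ≥ c`, the highest weight vector is `dd ^ c * xx 0 ^
z * yy 2 ^ b`, and the representation it generates is `dd ^ c` times the span of all monomials of
bidegree `(z, b)` in the first-row entries `xx p` and the signed minors `yy p` of the first two rows
(`irrepSub_eq_monoSpan`). The relation `xx_mul_yy` removes every monomial divisible by `xx 2 * yy
2`, and the remaining standard monomials form a basis (`linearIndependent_mono`). In this basis the
torus and ζ are diagonal, and J is a signed permutation exchanging the indices 0 and 1. Hence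
invariants are counted by fixed monomials, respectively by the J-orbits of fixed monomials whose
sign is not obstructed (`finrank_eq_card_orbitRep`). Explicit bijections identify these sets with
`Phi24` and `Phi44`.

This agrees with branching to U(2): a pair (p, q) of Φ labels a constituent of highest weight (p,
q). It has a vector of torus weight zero exactly when p - q is even; there ζ acts by i^(p+q) and J
by (-1)^((p-q)/2). The tables then come from counting residue classes modulo 4.

Schur expansion. By the dual Cauchy identity, ∏ᵢ ∏ⱼ (1 + xᵢ tⱼ) is the sum of S_λ(x) S_λ'(t). The
two products on the left are the points t = (i, -i, 1) and t = (1, 1, -1), and ω is the mean of the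
two values of S_λ'. Each value is a quotient of alternants, confluent at the second point. In place
of the Cauchy identity, `sum_smul_schur_eq_prod` proves by induction on the number of variables that
any coefficients obeying a three-row Pieri rule sum to a product, using the branching rule
`schur_succ`; `eight_mul_omega` matches the alternants with ω. -/

theorem card_Icc_filter_mod_four (b n r : ℕ) (hr : r < 4) :
    ((Finset.Icc b (b + n)).filter fun p => p % 4 = r).card
      = (b + n + 4 - r) / 4 - (b + 3 - r) / 4 := by
  -- The first quotient counts the naturals up to `b + n` in the class of `r`, the second those
  -- below `b`. Since `r < 4`, the subtractions of `r` do not truncate, even for `b = 0`.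
  induction n with
  | zero =>
    simp only [add_zero, Finset.Icc_self, Finset.filter_singleton]
    split_ifs with h
    · rw [Finset.card_singleton]; omega
    · rw [Finset.card_empty]; omega
  | succ n ih =>
    have h : Finset.Icc b (b + (n + 1)) = insert (b + n + 1) (Finset.Icc b (b + n)) := by
      ext x; simp only [Finset.mem_insert, Finset.mem_Icc]; omega
    rw [h, Finset.filter_insert]
    split_ifs with h'
    · rw [Finset.card_insert_of_notMem (by simp), ih]; omega
    · rw [ih]; omega

/-- Each full period of length 4 contributes one element, so only `u`, `w`, `r` enter the correction
term. Once residues are fixed the count is `n` plus a numeral. -/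
theorem card_Icc_filter_mod_four_of_decomp (b n u w r : ℕ) (hr : r < 4) :
    ((Finset.Icc (4 * b + u) (4 * b + u + (4 * n + w))).filter fun p => p % 4 = r).card
      = n + ((u + w + 4 - r) / 4 - (u + 3 - r) / 4) := by
  rw [card_Icc_filter_mod_four _ _ _ hr]; omega

/-- The class `r` of p forces the class `-r` of q; the two intervals are otherwise independent. -/
theorem card_Phi24 (a b c : ℕ) :
    (Phi24 a b c).card = ∑ r ∈ Finset.range 4,
      ((Finset.Icc b a).filter fun p => p % 4 = r).card *
        ((Finset.Icc c b).filter fun q => q % 4 = (4 - r) % 4).card := by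
  simp only [← Finset.card_product]
  rw [← Finset.card_biUnion]
  · refine congrArg Finset.card ?_
    ext ⟨p, q⟩
    rw [Phi24, Phi, Finset.mem_filter]
    simp only [Nat.ModEq, Finset.mem_filter, Finset.mem_product, Finset.mem_Icc,
      Finset.mem_biUnion, Finset.mem_range]
    constructor
    · rintro ⟨h, h'⟩
      exact ⟨p % 4, by omega, by omega, by omega⟩
    · rintro ⟨r, hr, h⟩
      omega
  · intro r _ s _ hrs
    rw [Function.onFun, Finset.disjoint_left]
    simp only [Finset.mem_product, Finset.mem_filter]
    omega

/-- The two congruences force p and q into a common class `r` with `2 * r` divisible by 4. -/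
theorem card_Phi44 (a b c : ℕ) :
    (Phi44 a b c).card = ∑ r ∈ {0, 2},
      ((Finset.Icc b a).filter fun p => p % 4 = r).card *
        ((Finset.Icc c b).filter fun q => q % 4 = r).card := by
  simp only [← Finset.card_product]
  rw [← Finset.card_biUnion]
  · refine congrArg Finset.card ?_
    ext ⟨p, q⟩
    rw [Phi44, Phi, Finset.mem_filter]
    simp only [Nat.ModEq, Finset.mem_filter, Finset.mem_product, Finset.mem_Icc,
      Finset.mem_biUnion, Finset.mem_insert, Finset.mem_singleton]
    constructor
    · rintro ⟨h, h'⟩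
      exact ⟨p % 4, by omega, by omega, by omega⟩
    · rintro ⟨r, hr, h⟩
      omega
  · intro r _ s _ hrs
    rw [Function.onFun, Finset.disjoint_left]
    simp only [Finset.mem_product, Finset.mem_filter]
    omega

theorem card_Phi24_of_decomp (e z₁ z₀ b₁ b₀ : ℕ) :
    (Phi24 (4 * z₁ + z₀ + (4 * b₁ + b₀) + e) (4 * b₁ + b₀ + e) e).card
      = ∑ r ∈ Finset.range 4,
        (z₁ + ((b₀ + e + z₀ + 4 - r) / 4 - (b₀ + e + 3 - r) / 4)) *
          (b₁ + ((e + b₀ + 4 - (4 - r) % 4) / 4 - (e + 3 - (4 - r) % 4) / 4)) := by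
  rw [card_Phi24]
  refine Finset.sum_congr rfl fun r hr => ?_
  have h₁ := card_Icc_filter_mod_four_of_decomp b₁ z₁ (b₀ + e) z₀ r (Finset.mem_range.1 hr)
  have h₂ := card_Icc_filter_mod_four_of_decomp 0 b₁ e b₀ ((4 - r) % 4) (by omega)
  rw [show 4 * b₁ + (b₀ + e) + (4 * z₁ + z₀) = 4 * z₁ + z₀ + (4 * b₁ + b₀) + e by ring,
    show 4 * b₁ + (b₀ + e) = 4 * b₁ + b₀ + e by ring] at h₁
  rw [show 4 * 0 + e + (4 * b₁ + b₀) = 4 * b₁ + b₀ + e by ring,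
    show 4 * 0 + e = e by ring] at h₂
  rw [← h₁, ← h₂]

theorem card_Phi44_of_decomp (e z₁ z₀ b₁ b₀ : ℕ) :
    (Phi44 (4 * z₁ + z₀ + (4 * b₁ + b₀) + e) (4 * b₁ + b₀ + e) e).card
      = ∑ r ∈ {0, 2},
        (z₁ + ((b₀ + e + z₀ + 4 - r) / 4 - (b₀ + e + 3 - r) / 4)) *
          (b₁ + ((e + b₀ + 4 - r) / 4 - (e + 3 - r) / 4)) := by
  rw [card_Phi44]
  refine Finset.sum_congr rfl fun r hr => ?_
  have hr' : r < 4 := by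
    simp only [Finset.mem_insert, Finset.mem_singleton] at hr
    omega
  have h₁ := card_Icc_filter_mod_four_of_decomp b₁ z₁ (b₀ + e) z₀ r hr'
  have h₂ := card_Icc_filter_mod_four_of_decomp 0 b₁ e b₀ r hr'
  rw [show 4 * b₁ + (b₀ + e) + (4 * z₁ + z₀) = 4 * z₁ + z₀ + (4 * b₁ + b₀) + e by ring,
    show 4 * b₁ + (b₀ + e) = 4 * b₁ + b₀ + e by ring] at h₁
  rw [show 4 * 0 + e + (4 * b₁ + b₀) = 4 * b₁ + b₀ + e by ring,
    show 4 * 0 + e = e by ring] at h₂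
  rw [← h₁, ← h₂]

theorem exists_decomp_mod_four (n : ℕ) : ∃ q, ∃ r : Fin 4, n = 4 * q + r :=
  ⟨n / 4, ⟨n % 4, Nat.mod_lt _ (by norm_num)⟩, (Nat.div_add_mod n 4).symm⟩

theorem ofNat_four_decomp (q r : ℕ) : Fin.ofNat 4 (4 * q + r) = Fin.ofNat 4 r := by
  ext; simp [Fin.ofNat]

theorem ofNat_two_decomp (q r : ℕ) : Fin.ofNat 2 (4 * q + r) = Fin.ofNat 2 r := by
  ext; simp only [Fin.ofNat]; omega

-- Fixing ε and the residues of z and b' modulo 4 makes every factor a quotient plus a constant, so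
-- each of the 32 cases is a polynomial identity in the two quotients.
set_option maxHeartbeats 1000000 in
theorem four_mul_card_Phi24 (ε : Fin 2) (z b' : ℕ) :
    4 * ((Phi24 (z + b' + ε) (b' + ε) ε).card : ℤ) = (z + 1) * (b' + 1) + kappa ε z b' := by
  obtain ⟨z₁, z₀, rfl⟩ := exists_decomp_mod_four z
  obtain ⟨b₁, b₀, rfl⟩ := exists_decomp_mod_four b'
  rw [card_Phi24_of_decomp, kappa, ofNat_four_decomp, ofNat_four_decomp]
  fin_cases ε <;> fin_cases z₀ <;> fin_cases b₀ <;>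
    simp [Finset.sum_range_succ, Fin.ofNat] <;> ring

set_option maxHeartbeats 1000000 in
theorem eight_mul_card_Phi44 (ε : Fin 2) (z b' : ℕ) :
    8 * ((Phi44 (z + b' + ε) (b' + ε) ε).card : ℤ)
      = b' * z + dot (eta ε z b') b' z + xi ε z b' := by
  obtain ⟨z₁, z₀, rfl⟩ := exists_decomp_mod_four z
  obtain ⟨b₁, b₀, rfl⟩ := exists_decomp_mod_four b'
  rw [card_Phi44_of_decomp, dot, eta, xi, ofNat_four_decomp, ofNat_four_decomp, ofNat_two_decomp,
    ofNat_two_decomp]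
  fin_cases ε <;> fin_cases z₀ <;> fin_cases b₀ <;>
    simp [Fin.ofNat] <;> ring

-- The terms in `b' * z` of the two counts cancel, which is why ω is linear on each residue class.
set_option maxHeartbeats 1000000 in
theorem four_mul_omega (ε : Fin 2) (z b' : ℕ) :
    4 * omega ε z b' = dot (alpha ε z b') b' z + beta ε z b' := by
  have h₁ := four_mul_card_Phi24 ε z b'
  have h₂ := eight_mul_card_Phi44 ε z b'
  rw [omega]
  have h : 4 * (2 * ((Phi44 (z + b' + ε) (b' + ε) ε).card : ℤ)
      - ((Phi24 (z + b' + ε) (b' + ε) ε).card : ℤ))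
      = (b' * z + dot (eta ε z b') b' z + xi ε z b') - ((z + 1) * (b' + 1) + kappa ε z b') := by
    linarith
  rw [h]
  obtain ⟨z₁, z₀, rfl⟩ := exists_decomp_mod_four z
  obtain ⟨b₁, b₀, rfl⟩ := exists_decomp_mod_four b'
  simp only [dot, eta, xi, alpha, beta, kappa, ofNat_four_decomp, ofNat_two_decomp]
  fin_cases ε <;> fin_cases z₀ <;> fin_cases b₀ <;>
    simp [Fin.ofNat] <;> ring

/-! ### The branching rule for Schur polynomials -/

theorem mem_partitionsIn {μ ν : YoungDiagram} : ν ∈ partitionsIn μ ↔ ν ≤ μ := by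
  simp [partitionsIn]

theorem mem_rect {m g i j : ℕ} : (i, j) ∈ rect m g ↔ i < m ∧ j < g := by
  rw [← YoungDiagram.mem_cells]
  simp [rect]

/-- The variable attached to a letter of the alphabet `{0, …, m - 1}`. -/
noncomputable def letter (m n : ℕ) : MvPolynomial (Fin m) ℚ :=
  if h : n < m then X ⟨n, h⟩ else 0

theorem schur_eq_sum_prod_letter (m : ℕ) (μ : YoungDiagram) :
    schur m μ = ∑ T : BoundedSSYT m μ, ∏ c ∈ μ.cells, letter m (T.1 c.1 c.2) := by
  refine Finset.sum_congr rfl fun T _ => ?_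
  rw [← Finset.prod_coe_sort μ.cells fun c => letter m (T.1 c.1 c.2)]
  refine Finset.prod_congr rfl fun c _ => ?_
  rw [letter, dif_pos (T.2 c.1 c.2)]

/-- `ν / μ` is a horizontal strip: no two of its cells lie in the same column. -/
def IsHorizontalStrip (μ ν : YoungDiagram) : Prop :=
  μ ≤ ν ∧ ∀ i j, (i + 1, j) ∈ ν → (i, j) ∈ μ

/-- Columns increase strictly from the top. This bounds the number of rows by the size of the
alphabet. -/
theorem le_entry {μ : YoungDiagram} (T : SemistandardYoungTableau μ) {i j : ℕ}
    (h : (i, j) ∈ μ) : i ≤ T i j := by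
  induction i with
  | zero => exact Nat.zero_le _
  | succ i ih =>
    have h₁ := ih (μ.up_left_mem (Nat.le_succ i) le_rfl h)
    have h₂ := T.col_strict (Nat.lt_add_one i) h
    omega

/-- The diagram of the cells of a tableau with entry less than `m`. -/
def subShape {ν : YoungDiagram} (T : SemistandardYoungTableau ν) (m : ℕ) : YoungDiagram where
  cells := ν.cells.filter fun c => T c.1 c.2 < m
  isLowerSet := by
    rintro ⟨i, j⟩ ⟨i', j'⟩ ⟨h₁, h₂⟩ h
    simp only [Finset.coe_filter, Set.mem_ofPred_eq, YoungDiagram.mem_cells] at h ⊢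
    have h₃ : (i', j) ∈ ν := ν.up_left_mem h₁ le_rfl h.1
    refine ⟨ν.up_left_mem h₁ h₂ h.1, ?_⟩
    exact lt_of_le_of_lt ((T.row_weak_of_le h₂ h₃).trans (T.col_weak h₁ h.1)) h.2

theorem mem_subShape {ν : YoungDiagram} (T : SemistandardYoungTableau ν) (m i j : ℕ) :
    (i, j) ∈ subShape T m ↔ (i, j) ∈ ν ∧ T i j < m := by
  rw [← YoungDiagram.mem_cells]
  simp [subShape]

/-- Restriction of a tableau to a smaller diagram. -/
def restrictTableau {μ ν : YoungDiagram} (h : μ ≤ ν) (T : SemistandardYoungTableau ν) :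
    SemistandardYoungTableau μ where
  entry i j := if (i, j) ∈ μ then T i j else 0
  row_weak' := by
    intro i j₁ j₂ hj hc
    rw [if_pos hc, if_pos (μ.up_left_mem le_rfl hj.le hc)]
    exact T.row_weak hj (h hc)
  col_strict' := by
    intro i₁ i₂ j hi hc
    rw [if_pos hc, if_pos (μ.up_left_mem hi.le le_rfl hc)]
    exact T.col_strict hi (h hc)
  zeros' := fun hc => if_neg hc

theorem restrictTableau_apply {μ ν : YoungDiagram} (h : μ ≤ ν) (T : SemistandardYoungTableau ν)
    (i j : ℕ) : restrictTableau h T i j = if (i, j) ∈ μ then T i j else 0 := rfl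

/-- Extension of a tableau with entries less than `m` by the letter `m` along a horizontal
strip. -/
def extendTableau {m : ℕ} {μ ν : YoungDiagram} (h : IsHorizontalStrip μ ν)
    (T : BoundedSSYT m μ) : SemistandardYoungTableau ν where
  entry i j := if (i, j) ∈ μ then T.1 i j else if (i, j) ∈ ν then m else 0
  row_weak' := by
    intro i j₁ j₂ hj hc
    have hc' := ν.up_left_mem le_rfl hj.le hc
    by_cases h₂ : (i, j₂) ∈ μ
    · rw [if_pos h₂, if_pos (μ.up_left_mem le_rfl hj.le h₂)]
      exact T.1.row_weak hj h₂
    · rw [if_neg h₂, if_pos hc, if_pos hc']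
      split_ifs with h₁
      · exact (T.2 _ ((YoungDiagram.mem_cells _).2 h₁)).le
      · exact le_rfl
  col_strict' := by
    intro i₁ i₂ j hi hc
    have h₁ : (i₁, j) ∈ μ := by
      obtain ⟨i, rfl⟩ : ∃ i, i₂ = i + 1 := ⟨i₂ - 1, by omega⟩
      exact μ.up_left_mem (by omega) le_rfl (h.2 i j hc)
    rw [if_pos h₁]
    by_cases h₂ : (i₂, j) ∈ μ
    · rw [if_pos h₂]
      exact T.1.col_strict hi h₂
    · rw [if_neg h₂, if_pos hc]
      exact T.2 _ ((YoungDiagram.mem_cells _).2 h₁)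
  zeros' := by
    intro i j hc
    rw [if_neg fun hc' => hc (h.1 hc'), if_neg hc]

theorem extendTableau_apply {m : ℕ} {μ ν : YoungDiagram} (h : IsHorizontalStrip μ ν)
    (T : BoundedSSYT m μ) (i j : ℕ) :
    extendTableau h T i j = if (i, j) ∈ μ then T.1 i j else if (i, j) ∈ ν then m else 0 := rfl

/-- Two removed cells in one column would both carry the letter `m`, against column strictness. -/
theorem isHorizontalStrip_subShape {m : ℕ} {ν : YoungDiagram} (T : BoundedSSYT (m + 1) ν) :
    IsHorizontalStrip (subShape T.1 m) ν := by
  constructor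
  · rintro ⟨i, j⟩ hc
    exact ((mem_subShape _ _ _ _).1 hc).1
  · intro i j hc
    have h₁ := T.1.col_strict (Nat.lt_add_one i) hc
    have h₂ := T.2 _ ((YoungDiagram.mem_cells _).2 hc)
    exact (mem_subShape _ _ _ _).2 ⟨ν.up_left_mem (Nat.le_succ i) le_rfl hc, by
      simp only at h₂; omega⟩

theorem subShape_le_rect {m g : ℕ} {ν : YoungDiagram} (hν : ν ≤ rect (m + 1) g)
    (T : BoundedSSYT (m + 1) ν) : subShape T.1 m ≤ rect m g := by
  rintro ⟨i, j⟩ hc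
  have hc := (mem_subShape _ _ _ _).1 hc
  have h₁ := le_entry T.1 hc.1
  exact mem_rect.2 ⟨by omega, (mem_rect.1 (hν hc.1)).2⟩

theorem letter_succ_of_lt {m n : ℕ} (h : n < m) :
    letter (m + 1) n = rename Fin.castSucc (letter m n) := by
  rw [letter, letter, dif_pos h, dif_pos (by omega), rename_X]
  rfl

theorem letter_succ_self (m : ℕ) : letter (m + 1) m = X (Fin.last m) := by
  rw [letter, dif_pos (Nat.lt_succ_self m)]
  rfl

open Classical in
/-- Removing the cells with the largest letter. -/
theorem schur_succ {m g : ℕ} {ν : YoungDiagram} (hν : ν ≤ rect (m + 1) g) :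
    schur (m + 1) ν
      = ∑ μ ∈ (partitionsIn (rect m g)).filter fun μ => IsHorizontalStrip μ ν,
          rename Fin.castSucc (schur m μ) * X (Fin.last m) ^ (ν.cells \ μ.cells).card := by
  rw [schur_eq_sum_prod_letter, ← Finset.sum_fiberwise_of_maps_to
    (g := fun T : BoundedSSYT (m + 1) ν => subShape T.1 m)
    (t := (partitionsIn (rect m g)).filter fun μ => IsHorizontalStrip μ ν)]
  swap
  · intro T _
    exact Finset.mem_filter.2
      ⟨mem_partitionsIn.2 (subShape_le_rect hν T), isHorizontalStrip_subShape T⟩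
  refine Finset.sum_congr rfl fun μ hμ => ?_
  have hs : IsHorizontalStrip μ ν := (Finset.mem_filter.1 hμ).2
  rw [schur_eq_sum_prod_letter, map_sum, Finset.sum_mul]
  have hmem : ∀ {T : BoundedSSYT (m + 1) ν}, subShape T.1 m = μ → ∀ i j,
      (i, j) ∈ μ ↔ (i, j) ∈ ν ∧ T.1 i j < m := by
    rintro T rfl i j
    exact mem_subShape T.1 m i j
  -- On the fibre over `μ` every cell outside `μ` carries the letter `m`, so a tableau is recovered
  -- from its restriction to `μ`.
  refine Finset.sum_bij'
    (fun T hT => ⟨restrictTableau (μ := μ) hs.1 T.1, ?_⟩)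
    (fun T _ => ⟨extendTableau hs T, ?_⟩) ?_ ?_ ?_ ?_ ?_
  · rintro ⟨i, j⟩ hc
    have hc := (YoungDiagram.mem_cells _).1 hc
    rw [restrictTableau_apply, if_pos hc]
    exact ((hmem (Finset.mem_filter.1 hT).2 i j).1 hc).2
  · rintro ⟨i, j⟩ hc
    have hc := (YoungDiagram.mem_cells _).1 hc
    rw [extendTableau_apply]
    split_ifs with h
    · exact (T.2 _ ((YoungDiagram.mem_cells _).2 h)).trans (Nat.lt_succ_self m)
    · exact Nat.lt_succ_self m
  · intro T _
    exact Finset.mem_univ _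
  · intro T _
    refine Finset.mem_filter.2 ⟨Finset.mem_univ _, ?_⟩
    apply YoungDiagram.ext
    ext ⟨i, j⟩
    rw [YoungDiagram.mem_cells, YoungDiagram.mem_cells, mem_subShape, extendTableau_apply]
    by_cases h : (i, j) ∈ μ
    · simp only [h, if_true, iff_true]
      exact ⟨hs.1 h, T.2 _ ((YoungDiagram.mem_cells _).2 h)⟩
    · simp only [h, if_false, iff_false]
      rintro ⟨h₁, h₂⟩
      rw [if_pos h₁] at h₂
      exact lt_irrefl _ h₂
  · intro T hT
    apply Subtype.ext
    ext i j
    have h := hmem (Finset.mem_filter.1 hT).2 i j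
    simp only [extendTableau_apply, restrictTableau_apply]
    by_cases h₁ : (i, j) ∈ μ
    · rw [if_pos h₁, if_pos h₁]
    · rw [if_neg h₁]
      by_cases h₂ : (i, j) ∈ ν
      · have h₃ := T.2 _ ((YoungDiagram.mem_cells _).2 h₂)
        simp only at h₃
        rw [if_pos h₂]
        by_contra h₄
        exact h₁ (h.2 ⟨h₂, by omega⟩)
      · rw [if_neg h₂, T.1.zeros h₂]
  · intro T hT
    apply Subtype.ext
    ext i j
    simp only [extendTableau_apply, restrictTableau_apply]
    by_cases h₁ : (i, j) ∈ μ
    · rw [if_pos h₁, if_pos h₁]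
    · rw [if_neg h₁, T.1.zeros h₁]
  · intro T hT
    have h := fun i j => hmem (Finset.mem_filter.1 hT).2 i j
    rw [← Finset.prod_sdiff (YoungDiagram.cells_subset_iff.2 hs.1), mul_comm]
    congr 1
    · rw [map_prod]
      refine Finset.prod_congr rfl ?_
      rintro ⟨i, j⟩ hc
      have hc := (YoungDiagram.mem_cells _).1 hc
      simp only [restrictTableau_apply, if_pos hc]
      exact letter_succ_of_lt ((h i j).1 hc).2
    · rw [← Finset.prod_const]
      refine Finset.prod_congr rfl ?_
      rintro ⟨i, j⟩ hc
      rw [Finset.mem_sdiff, YoungDiagram.mem_cells, YoungDiagram.mem_cells, h] at hc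
      have h₃ := T.2 _ ((YoungDiagram.mem_cells _).2 hc.1)
      have h₄ : ¬ T.1 i j < m := fun h' => hc.2 ⟨hc.1, h'⟩
      simp only at h₃ ⊢
      rw [show T.1 i j = m by omega, letter_succ_self]

/-! ### Partitions with at most three columns -/

/-- The diagram with columns of lengths `a ≥ b ≥ c`. -/
def ofCols (a b c : ℕ) : YoungDiagram where
  -- The last column also requires `x.1 < b`, so that this is a lower set for all `a`, `b`, `c`,
  -- ordered or not.
  cells := ((Finset.range a ×ˢ Finset.range 3).filter fun x =>
    (1 ≤ x.2 → x.1 < b) ∧ (2 ≤ x.2 → x.1 < b ∧ x.1 < c))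
  isLowerSet := by
    rintro ⟨i, j⟩ ⟨i', j'⟩ ⟨h₁, h₂⟩ h
    simp only [Finset.coe_filter, Set.mem_ofPred_eq, Finset.mem_product, Finset.mem_range]
      at h h₁ h₂ ⊢
    omega

theorem mem_ofCols {a b c i j : ℕ} (hab : b ≤ a) (hbc : c ≤ b) :
    (i, j) ∈ ofCols a b c ↔ (j = 0 ∧ i < a) ∨ (j = 1 ∧ i < b) ∨ (j = 2 ∧ i < c) := by
  rw [← YoungDiagram.mem_cells]
  simp only [ofCols, Finset.mem_filter, Finset.mem_product, Finset.mem_range]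
  omega

theorem colLen_eq_of_forall {μ : YoungDiagram} {j n : ℕ} (h : ∀ i, (i, j) ∈ μ ↔ i < n) :
    μ.colLen j = n := by
  refine le_antisymm ?_ ?_
  · by_contra! hlt
    exact lt_irrefl n ((h n).1 (YoungDiagram.mem_iff_lt_colLen.2 hlt))
  · by_contra! hlt
    exact lt_irrefl _ (YoungDiagram.mem_iff_lt_colLen.1 ((h _).2 hlt))

theorem colLen_ofCols {a b c : ℕ} (hab : b ≤ a) (hbc : c ≤ b) :
    (ofCols a b c).colLen 0 = a ∧ (ofCols a b c).colLen 1 = b ∧ (ofCols a b c).colLen 2 = c := by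
  refine ⟨?_, ?_, ?_⟩ <;> refine colLen_eq_of_forall fun i => ?_ <;> rw [mem_ofCols hab hbc] <;>
    omega

theorem le_rect_three_iff {m : ℕ} {μ : YoungDiagram} :
    μ ≤ rect m 3 ↔ μ.colLen 0 ≤ m ∧ ∀ i j, (i, j) ∈ μ → j < 3 := by
  constructor
  · intro h
    refine ⟨?_, fun i j hc => (mem_rect.1 (h hc)).2⟩
    by_contra! hlt
    exact lt_irrefl m (mem_rect.1 (h (YoungDiagram.mem_iff_lt_colLen.2 hlt))).1
  · rintro ⟨h₁, h₂⟩ ⟨i, j⟩ hc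
    have h₃ := YoungDiagram.mem_iff_lt_colLen.1 (μ.up_left_mem le_rfl (Nat.zero_le j) hc)
    exact mem_rect.2 ⟨by omega, h₂ i j hc⟩

theorem ofCols_colLen {m : ℕ} {μ : YoungDiagram} (h : μ ≤ rect m 3) :
    ofCols (μ.colLen 0) (μ.colLen 1) (μ.colLen 2) = μ := by
  apply YoungDiagram.ext
  ext ⟨i, j⟩
  rw [YoungDiagram.mem_cells, YoungDiagram.mem_cells,
    mem_ofCols (μ.colLen_anti 0 1 (by omega)) (μ.colLen_anti 1 2 (by omega))]
  constructor
  · rintro (⟨rfl, h'⟩ | ⟨rfl, h'⟩ | ⟨rfl, h'⟩) <;> exact YoungDiagram.mem_iff_lt_colLen.2 h'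
  · intro hc
    have hj := (le_rect_three_iff.1 h).2 i j hc
    have hc := YoungDiagram.mem_iff_lt_colLen.1 hc
    interval_cases j <;> simp_all

theorem ofCols_le_rect {m a b c : ℕ} (hab : b ≤ a) (hbc : c ≤ b) (ha : a ≤ m) :
    ofCols a b c ≤ rect m 3 := by
  rw [le_rect_three_iff]
  refine ⟨by rwa [(colLen_ofCols hab hbc).1], fun i j hc => ?_⟩
  rw [mem_ofCols hab hbc] at hc
  omega

/-- In column lengths a horizontal strip adds 0 or 1 to each of the three parts of the transpose,
which is the shape of the Pieri rule used below. -/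
theorem isHorizontalStrip_iff {m : ℕ} {μ ν : YoungDiagram} (hν : ν ≤ rect m 3) :
    IsHorizontalStrip μ ν ↔ μ ≤ rect m 3 ∧
      ∀ j < 3, μ.colLen j ≤ ν.colLen j ∧ ν.colLen j ≤ μ.colLen j + 1 := by
  constructor
  · rintro ⟨h₁, h₂⟩
    refine ⟨h₁.trans hν, fun j _ => ⟨?_, ?_⟩⟩
    · by_contra! hlt
      exact lt_irrefl _ (YoungDiagram.mem_iff_lt_colLen.1
        (h₁ (YoungDiagram.mem_iff_lt_colLen.2 hlt)))
    · by_contra! hlt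
      exact lt_irrefl _ (YoungDiagram.mem_iff_lt_colLen.1
        (h₂ _ _ (YoungDiagram.mem_iff_lt_colLen.2 hlt)))
  · rintro ⟨hμ, h⟩
    constructor
    · rintro ⟨i, j⟩ hc
      have hj := (le_rect_three_iff.1 hμ).2 i j hc
      exact YoungDiagram.mem_iff_lt_colLen.2
        (lt_of_lt_of_le (YoungDiagram.mem_iff_lt_colLen.1 hc) (h j hj).1)
    · intro i j hc
      have hj := (le_rect_three_iff.1 hν).2 _ j hc
      have := YoungDiagram.mem_iff_lt_colLen.1 hc
      exact YoungDiagram.mem_iff_lt_colLen.2 (by have := (h j hj).2; omega)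

theorem card_cells_of_le_rect {m : ℕ} {μ : YoungDiagram} (h : μ ≤ rect m 3) :
    μ.cells.card = μ.colLen 0 + μ.colLen 1 + μ.colLen 2 := by
  rw [Finset.card_eq_sum_card_fiberwise (f := Prod.snd) (t := Finset.range 3)]
  · simp only [Finset.sum_range_succ, Finset.sum_range_zero, zero_add,
      YoungDiagram.colLen_eq_card, YoungDiagram.col]
  · rintro ⟨i, j⟩ hc
    exact Finset.mem_coe.2 (Finset.mem_range.2
      ((le_rect_three_iff.1 h).2 i j ((YoungDiagram.mem_cells _).1 hc)))

theorem card_sdiff_of_isHorizontalStrip {m : ℕ} {μ ν : YoungDiagram} (hν : ν ≤ rect m 3)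
    (h : IsHorizontalStrip μ ν) :
    (ν.cells \ μ.cells).card = (ν.colLen 0 - μ.colLen 0) + (ν.colLen 1 - μ.colLen 1)
      + (ν.colLen 2 - μ.colLen 2) := by
  have h' := (isHorizontalStrip_iff hν).1 h
  rw [Finset.card_sdiff_of_subset (YoungDiagram.cells_subset_iff.2 h.1),
    card_cells_of_le_rect hν, card_cells_of_le_rect h'.1]
  have h₀ := h'.2 0 (by omega)
  have h₁ := h'.2 1 (by omega)
  have h₂ := h'.2 2 (by omega)
  omega

open Classical in
/-- A sum over the ways of adding a horizontal strip, as a sum over column lengths. -/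
theorem sum_isHorizontalStrip {M : Type*} [AddCommMonoid M] {m : ℕ} {μ : YoungDiagram}
    (hμ : μ ≤ rect m 3) (f : ℕ → ℕ → ℕ → M) :
    ∑ ν ∈ (partitionsIn (rect (m + 1) 3)).filter fun ν => IsHorizontalStrip μ ν,
        f (ν.colLen 0) (ν.colLen 1) (ν.colLen 2)
      = ∑ x ∈ (Finset.Icc (μ.colLen 0) (μ.colLen 0 + 1) ×ˢ Finset.Icc (μ.colLen 1)
          (μ.colLen 1 + 1) ×ˢ Finset.Icc (μ.colLen 2) (μ.colLen 2 + 1)).filter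
            (fun x => x.2.1 ≤ x.1 ∧ x.2.2 ≤ x.2.1), f x.1 x.2.1 x.2.2 := by
  have hμ' : μ ≤ rect (m + 1) 3 := by
    rw [le_rect_three_iff] at hμ ⊢
    exact ⟨by omega, hμ.2⟩
  refine Finset.sum_bij' (fun ν _ => (ν.colLen 0, ν.colLen 1, ν.colLen 2))
    (fun x _ => ofCols x.1 x.2.1 x.2.2) ?_ ?_ ?_ ?_ ?_
  · intro ν hν
    rw [Finset.mem_filter, mem_partitionsIn] at hν
    have h := ((isHorizontalStrip_iff hν.1).1 hν.2).2
    simp only [Finset.mem_filter, Finset.mem_product, Finset.mem_Icc]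
    exact ⟨⟨h 0 (by omega), h 1 (by omega), h 2 (by omega)⟩, ν.colLen_anti 0 1 (by omega),
      ν.colLen_anti 1 2 (by omega)⟩
  · rintro ⟨a, b, c⟩ hx
    simp only [Finset.mem_filter, Finset.mem_product, Finset.mem_Icc] at hx
    have h := colLen_ofCols hx.2.1 hx.2.2
    have hr : ofCols a b c ≤ rect (m + 1) 3 :=
      ofCols_le_rect hx.2.1 hx.2.2 (by have := (le_rect_three_iff.1 hμ).1; omega)
    rw [Finset.mem_filter, mem_partitionsIn, isHorizontalStrip_iff hr]
    refine ⟨hr, hμ', fun j hj => ?_⟩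
    interval_cases j <;> simp only [h] <;> omega
  · intro ν hν
    rw [Finset.mem_filter, mem_partitionsIn] at hν
    exact ofCols_colLen hν.1
  · rintro ⟨a, b, c⟩ hx
    rw [Finset.mem_filter] at hx
    simp only [colLen_ofCols hx.2.1 hx.2.2]
  · intro ν _
    rfl

/-- The value of the polynomial `1 + p₁ x + p₂ x² + p₃ x³`. -/
def cubic {R : Type*} [CommRing R] (p₁ p₂ p₃ : ℤ) (x : R) : R :=
  1 + p₁ * x + p₂ * x ^ 2 + p₃ * x ^ 3

theorem map_cubic {R S : Type*} [CommRing R] [CommRing S] (f : R →+* S) (p₁ p₂ p₃ : ℤ) (x : R) :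
    f (cubic p₁ p₂ p₃ x) = cubic p₁ p₂ p₃ (f x) := by
  simp [cubic]

/-- If the coefficients `D` satisfy the Pieri rule with respect to `1 + p₁ x + p₂ x² + p₃ x³`,
then `∑ D(μ) S_μ` is a product. -/
theorem sum_smul_schur_eq_prod (D : ℕ → ℕ → ℕ → ℤ) (p₁ p₂ p₃ : ℤ)
    (h₁ : ∀ b c, D b (b + 1) c = 0) (h₂ : ∀ a c, D a c (c + 1) = 0)
    (hD : ∀ (R : Type) [CommRing R] (x : R) (a b c : ℕ),
      (D a b c : R) + x * (D (a + 1) b c + D a (b + 1) c + D a b (c + 1))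
        + x ^ 2 * (D (a + 1) (b + 1) c + D (a + 1) b (c + 1) + D a (b + 1) (c + 1))
        + x ^ 3 * D (a + 1) (b + 1) (c + 1)
      = cubic p₁ p₂ p₃ x * D a b c) (m : ℕ) :
    ∑ μ ∈ partitionsIn (rect m 3),
        (D (μ.colLen 0) (μ.colLen 1) (μ.colLen 2) : MvPolynomial (Fin m) ℚ) * schur m μ
      = (D 0 0 0 : MvPolynomial (Fin m) ℚ)
        * ∏ i : Fin m, cubic p₁ p₂ p₃ (X i) := by
  classical
  induction m with
  | zero =>
    have hr : rect 0 3 = ⊥ := by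
      apply YoungDiagram.ext
      simp [rect]
    have hp : partitionsIn (rect 0 3) = {⊥} := by
      ext μ
      rw [mem_partitionsIn, hr, le_bot_iff, Finset.mem_singleton]
    have hc : ∀ j, (⊥ : YoungDiagram).colLen j = 0 := fun j =>
      colLen_eq_of_forall fun i => by simp
    have : Unique (BoundedSSYT 0 ⊥) :=
      { default := ⟨default, by simp⟩
        uniq := fun T => Subtype.ext (SemistandardYoungTableau.ext fun i j => by
          rw [T.1.zeros (by simp), SemistandardYoungTableau.zeros _ (by simp)]) }
    rw [hp, Finset.sum_singleton, hc, hc, hc, schur_eq_sum_prod_letter]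
    simp
  | succ m ih =>
    have step : ∀ μ ∈ partitionsIn (rect m 3),
        ∑ ν ∈ (partitionsIn (rect (m + 1) 3)).filter fun ν => IsHorizontalStrip μ ν,
          (D (ν.colLen 0) (ν.colLen 1) (ν.colLen 2) : MvPolynomial (Fin (m + 1)) ℚ)
            * X (Fin.last m) ^ ((ν.colLen 0 - μ.colLen 0) + (ν.colLen 1 - μ.colLen 1)
              + (ν.colLen 2 - μ.colLen 2))
        = cubic p₁ p₂ p₃ (X (Fin.last m))
            * (D (μ.colLen 0) (μ.colLen 1) (μ.colLen 2) : MvPolynomial (Fin (m + 1)) ℚ) := by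
      intro μ hμ
      rw [mem_partitionsIn] at hμ
      rw [sum_isHorizontalStrip hμ fun a b c =>
        (D a b c : MvPolynomial (Fin (m + 1)) ℚ) * X (Fin.last m) ^ ((a - μ.colLen 0)
          + (b - μ.colLen 1) + (c - μ.colLen 2))]
      have hab := μ.colLen_anti 0 1 (by omega)
      have hbc := μ.colLen_anti 1 2 (by omega)
      generalize μ.colLen 0 = a at *
      generalize μ.colLen 1 = b at *
      generalize μ.colLen 2 = c at *
      -- The ordering condition can be dropped: starting from `c ≤ b ≤ a`, raising parts by at most
      -- one can break the order only by exactly one, and there `D` vanishes by `h₁` or `h₂`.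
      rw [Finset.sum_filter_of_ne, ← hD]
      · have hI : ∀ n : ℕ, Finset.Icc n (n + 1) = {n, n + 1} := fun n => by
          ext x; simp only [Finset.mem_Icc, Finset.mem_insert, Finset.mem_singleton]; omega
        have hn : ∀ n : ℕ, n ∉ ({n + 1} : Finset ℕ) := fun n => by simp
        simp only [Finset.sum_product, hI, Finset.sum_insert (hn _), Finset.sum_singleton,
          Nat.sub_self, Nat.add_sub_cancel_left]
        ring
      · rintro ⟨a', b', c'⟩ hx hne
        simp only [Finset.mem_product, Finset.mem_Icc] at hx
        by_contra hcon
        refine hne ?_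
        simp only at hcon ⊢
        by_cases hb : b' ≤ a'
        · have : c' = b' + 1 := by omega
          rw [this, h₂, Int.cast_zero, zero_mul]
        · have : b' = a' + 1 := by omega
          rw [this, h₁, Int.cast_zero, zero_mul]
    -- Branch every Schur polynomial, exchange the sums over `ν` and `μ`, and let `step` evaluate
    -- the inner sum over `ν`.
    calc _ = ∑ ν ∈ partitionsIn (rect (m + 1) 3), ∑ μ ∈ partitionsIn (rect m 3),
          if IsHorizontalStrip μ ν then
            (D (ν.colLen 0) (ν.colLen 1) (ν.colLen 2) : MvPolynomial (Fin (m + 1)) ℚ)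
              * X (Fin.last m) ^ ((ν.colLen 0 - μ.colLen 0) + (ν.colLen 1 - μ.colLen 1)
                + (ν.colLen 2 - μ.colLen 2)) * rename Fin.castSucc (schur m μ) else 0 := by
          refine Finset.sum_congr rfl fun ν hν => ?_
          rw [mem_partitionsIn] at hν
          rw [schur_succ hν, Finset.mul_sum, ← Finset.sum_filter]
          refine Finset.sum_congr rfl fun μ hμ => ?_
          rw [card_sdiff_of_isHorizontalStrip hν (Finset.mem_filter.1 hμ).2]
          ring
      _ = ∑ μ ∈ partitionsIn (rect m 3),
            cubic p₁ p₂ p₃ (X (Fin.last m))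
            * rename Fin.castSucc
              ((D (μ.colLen 0) (μ.colLen 1) (μ.colLen 2) : MvPolynomial (Fin m) ℚ) * schur m μ) := by
          rw [Finset.sum_comm]
          refine Finset.sum_congr rfl fun μ hμ => ?_
          rw [← Finset.sum_filter, ← Finset.sum_mul, step μ hμ, map_mul, map_intCast]
          ring
      _ = _ := by
          rw [← Finset.mul_sum, ← map_sum, ih, Fin.prod_univ_castSucc]
          have h : ∀ i : Fin m, rename Fin.castSucc (cubic p₁ p₂ p₃ (X i : MvPolynomial _ ℚ))
              = cubic p₁ p₂ p₃ (X i.castSucc) := fun i => by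
            rw [← AlgHom.coe_toRingHom, map_cubic, AlgHom.coe_toRingHom, rename_X]
          simp only [map_mul, map_prod, map_intCast, h]
          ring

/-! ### The coefficients of the two products -/

/-- `(cos (nπ/2), sin (nπ/2))`. -/
def quarterTurn : ℕ → ℤ × ℤ
  | 0 => (1, 0)
  | n + 1 => (-(quarterTurn n).2, (quarterTurn n).1)

theorem quarterTurn_succ (n : ℕ) :
    quarterTurn (n + 1) = (-(quarterTurn n).2, (quarterTurn n).1) := rfl

theorem quarterTurn_four_mul_add (q r : ℕ) : quarterTurn (4 * q + r) = quarterTurn r := by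
  induction q with
  | zero => simp
  | succ q ih =>
    rw [show 4 * (q + 1) + r = 4 * q + r + 1 + 1 + 1 + 1 by ring]
    simp [quarterTurn_succ, ih]

/-- The alternant of the partition with parts `a, b, c` at the point `(i, -i, 1)`, in real form. -/
def altFour (a b c : ℕ) : ℤ :=
  Matrix.det !![(quarterTurn (a + 2)).1, (quarterTurn (a + 2)).2, 1;
    (quarterTurn (b + 1)).1, (quarterTurn (b + 1)).2, 1;
    (quarterTurn c).1, (quarterTurn c).2, 1]

/-- The alternant of the partition with parts `a, b, c` at the point `(1, -1, 1)`, with the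
confluent columns `1` and `n`. -/
def altTwo (a b c : ℕ) : ℤ :=
  Matrix.det !![1, (a + 2 : ℤ), (-1) ^ (a + 2); 1, (b + 1 : ℤ), (-1) ^ (b + 1);
    1, (c : ℤ), (-1) ^ c]

/-- Replacing an exponent n by n + 1 multiplies a row of the alternant by a fixed matrix M, a
quarter turn plus a 1. Expanding the determinant of the rows v + x v M gives the Pieri rule with
factor det(1 + x M) = (1 + x)(1 + x²). The vanishing conditions are equal rows, and -2 is the value
at the empty partition. -/
theorem sum_altFour_mul_schur (m : ℕ) :
    ∑ μ ∈ partitionsIn (rect m 3),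
        (altFour (μ.colLen 0) (μ.colLen 1) (μ.colLen 2) : MvPolynomial (Fin m) ℚ) * schur m μ
      = -2 * ∏ i : Fin m, (1 + X i) * (1 + X i ^ 2) := by
  rw [sum_smul_schur_eq_prod altFour 1 1 1]
  · congr 1
    · rw [show altFour 0 0 0 = -2 by simp [altFour, Matrix.det_fin_three, quarterTurn]]
      norm_num
    · refine Finset.prod_congr rfl fun i _ => ?_
      simp only [cubic]
      push_cast
      ring
  · intro b c
    simp only [altFour, Matrix.det_fin_three, quarterTurn_succ]
    simp
    ring
  · intro a c
    simp only [altFour, Matrix.det_fin_three, quarterTurn_succ]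
    simp
    ring
  · intro R _ x a b c
    simp only [altFour, Matrix.det_fin_three, quarterTurn_succ, cubic]
    simp
    ring

/-- The same argument applies; the shift n ↦ n + 1 now acts on the columns 1, n by a Jordan block
and on the third by -1, so det(1 + x M) = (1 + x)²(1 - x). -/
theorem sum_altTwo_mul_schur (m : ℕ) :
    ∑ μ ∈ partitionsIn (rect m 3),
        (altTwo (μ.colLen 0) (μ.colLen 1) (μ.colLen 2) : MvPolynomial (Fin m) ℚ) * schur m μ
      = -4 * ∏ i : Fin m, (1 + X i) * (1 - X i ^ 2) := by
  rw [sum_smul_schur_eq_prod altTwo 1 (-1) (-1)]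
  · congr 1
    · rw [show altTwo 0 0 0 = -4 by simp [altTwo, Matrix.det_fin_three]]
      norm_num
    · refine Finset.prod_congr rfl fun i _ => ?_
      simp only [cubic]
      push_cast
      ring
  · intro b c
    simp only [altTwo, Matrix.det_fin_three]
    simp
    ring
  · intro a c
    simp only [altTwo, Matrix.det_fin_three]
    simp
    ring
  · intro R _ x a b c
    simp only [altTwo, Matrix.det_fin_three, cubic]
    simp
    ring

/-- A shift by 2 negates the cosine and the sine column, and the two signs cancel. -/
theorem altFour_add_two_mul (a b c k : ℕ) :
    altFour (a + 2 * k) (b + 2 * k) (c + 2 * k) = altFour a b c := by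
  induction k with
  | zero => simp
  | succ k ih =>
    rw [← ih]
    simp only [altFour, Matrix.det_fin_three, mul_add, mul_one, ← add_assoc, quarterTurn_succ]
    simp

/-- A shift by `2 * k` adds a multiple of the constant column to the linear one and keeps the parity
column. -/
theorem altTwo_add_two_mul (a b c k : ℕ) :
    altTwo (a + 2 * k) (b + 2 * k) (c + 2 * k) = altTwo a b c := by
  simp only [altTwo, Matrix.det_fin_three]
  simp [pow_add, pow_mul]
  ring

-- Dividing by the normalizations -2 and -4, this says that 2ω is the sum of the Schur values at (i,
-- -i, 1) and (1, 1, -1). Both sides are linear on classes modulo 4, so it is checked case by case.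
set_option maxHeartbeats 1000000 in
theorem eight_mul_omega (ε : Fin 2) (z b' k : ℕ) :
    8 * omega ε z b' = -2 * altFour (z + b' + ε + 2 * k) (b' + ε + 2 * k) (ε + 2 * k)
      - altTwo (z + b' + ε + 2 * k) (b' + ε + 2 * k) (ε + 2 * k) := by
  rw [altFour_add_two_mul, altTwo_add_two_mul]
  have h := four_mul_omega ε z b'
  have h' : 8 * omega ε z b' = 2 * (dot (alpha ε z b') b' z + beta ε z b') := by linarith
  rw [h']
  obtain ⟨z₁, z₀, rfl⟩ := exists_decomp_mod_four z
  obtain ⟨b₁, b₀, rfl⟩ := exists_decomp_mod_four b'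
  have e₁ : (-1 : ℤ) ^ (4 * z₁ + z₀ + (4 * b₁ + b₀) + ε + 2)
      = (-1) ^ ((z₀ : ℕ) + b₀ + ε) := by
    rw [show 4 * z₁ + (z₀ : ℕ) + (4 * b₁ + b₀) + ε + 2
      = (z₀ + b₀ + ε) + 2 * (2 * z₁ + 2 * b₁ + 1) by ring, pow_add, pow_mul]
    simp
  have e₂ : (-1 : ℤ) ^ (4 * b₁ + (b₀ : ℕ) + ε + 1) = (-1) ^ ((b₀ : ℕ) + ε + 1) := by
    rw [show 4 * b₁ + (b₀ : ℕ) + ε + 1 = (b₀ + ε + 1) + 2 * (2 * b₁) by ring, pow_add, pow_mul]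
    simp
  have e₃ : quarterTurn (4 * z₁ + z₀ + (4 * b₁ + b₀) + ε + 2)
      = quarterTurn (z₀ + b₀ + ε + 2) := by
    rw [← quarterTurn_four_mul_add (z₁ + b₁) (z₀ + b₀ + ε + 2)]
    congr 1; ring
  have e₄ : quarterTurn (4 * b₁ + b₀ + ε + 1) = quarterTurn (b₀ + ε + 1) := by
    rw [← quarterTurn_four_mul_add b₁ (b₀ + ε + 1)]
    congr 1; ring
  simp only [dot, alpha, beta, ofNat_four_decomp, ofNat_two_decomp, altFour, altTwo,
    Matrix.det_fin_three, e₁, e₂, e₃, e₄]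
  fin_cases ε <;> fin_cases z₀ <;> fin_cases b₀ <;>
    simp [Fin.ofNat, quarterTurn] <;> ring

theorem eight_mul_omegaOf (μ : YoungDiagram) :
    8 * omegaOf μ = -2 * altFour (μ.colLen 0) (μ.colLen 1) (μ.colLen 2)
      - altTwo (μ.colLen 0) (μ.colLen 1) (μ.colLen 2) := by
  have hab := μ.colLen_anti 0 1 (by omega)
  have hbc := μ.colLen_anti 1 2 (by omega)
  -- The third part of the transpose is split as ε + 2k by division with remainder.
  rw [omegaOf, eight_mul_omega _ _ _ (μ.colLen 2 / 2)]
  have h : ((Fin.ofNat 2 (μ.colLen 2) : Fin 2) : ℕ) = μ.colLen 2 % 2 := rfl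
  rw [h]
  congr 2 <;> congr 1 <;> omega

theorem half_sum_prod_eq_sum_omegaOf_smul_schur (m : ℕ) :
    C (1 / 2 : ℚ) * ((∏ i : Fin m, (1 + X i) * (1 + X i ^ 2))
        + ∏ i : Fin m, (1 + X i) * (1 - X i ^ 2))
      = ∑ μ ∈ partitionsIn (rect m 3), omegaOf μ • schur m μ := by
  have h : (8 : MvPolynomial (Fin m) ℚ)
      * ∑ μ ∈ partitionsIn (rect m 3), omegaOf μ • schur m μ
      = 4 * ((∏ i : Fin m, (1 + X i) * (1 + X i ^ 2))
        + ∏ i : Fin m, (1 + X i) * (1 - X i ^ 2)) := by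
    have h₁ := sum_altFour_mul_schur m
    have h₂ := sum_altTwo_mul_schur m
    have h₃ : (8 : MvPolynomial (Fin m) ℚ)
        * ∑ μ ∈ partitionsIn (rect m 3), omegaOf μ • schur m μ
        = -2 * ∑ μ ∈ partitionsIn (rect m 3),
            (altFour (μ.colLen 0) (μ.colLen 1) (μ.colLen 2) : MvPolynomial (Fin m) ℚ) * schur m μ
          - ∑ μ ∈ partitionsIn (rect m 3),
            (altTwo (μ.colLen 0) (μ.colLen 1) (μ.colLen 2) : MvPolynomial (Fin m) ℚ)
              * schur m μ := by
      rw [Finset.mul_sum, Finset.mul_sum, ← Finset.sum_sub_distrib]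
      refine Finset.sum_congr rfl fun μ _ => ?_
      have h₄ := congrArg (Int.cast : ℤ → MvPolynomial (Fin m) ℚ) (eight_mul_omegaOf μ)
      push_cast at h₄
      rw [zsmul_eq_mul, ← mul_assoc, h₄]
      ring
    rw [h₃, h₁, h₂]
    ring
  have h8 : (8 : MvPolynomial (Fin m) ℚ) = C 8 := rfl
  have h4 : (4 : MvPolynomial (Fin m) ℚ) = C 8 * C (1 / 2) := by
    rw [← C_mul]; norm_num; rfl
  rw [h8, h4, mul_assoc] at h
  exact (mul_left_cancel₀ (by simp) h).symm

/-! ### Counting exponents of invariant monomials -/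

/-- The exponents of a monomial `X₀ⁱ X₁ʲ X₂ᵏ Y₀ˡ Y₁ᵐ Y₂ⁿ`. -/
@[ext]
structure Exps where
  i : ℕ
  j : ℕ
  k : ℕ
  l : ℕ
  m : ℕ
  n : ℕ

/-- The exponents of bidegree `(z, b)`. -/
def bidegExps (z b : ℕ) : Set Exps := {s | s.i + s.j + s.k = z ∧ s.l + s.m + s.n = b}

/-- The exponents of bidegree `(z, b)` of the monomials that are not divisible by `X₂ Y₂`. -/
def stdExps (z b : ℕ) : Set Exps :=
  {s | (s.i + s.j + s.k = z ∧ s.l + s.m + s.n = b) ∧ (s.k = 0 ∨ s.n = 0)}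

/-- Exchange of the indices `0` and `1`. -/
def Exps.swap (s : Exps) : Exps := ⟨s.j, s.i, s.k, s.m, s.l, s.n⟩

theorem swap_mem_stdExps {z b : ℕ} {s : Exps} (hs : s ∈ stdExps z b) : s.swap ∈ stdExps z b := by
  obtain ⟨⟨h₁, h₂⟩, h₃⟩ := hs
  exact ⟨⟨by simp only [Exps.swap]; omega, by simp only [Exps.swap]; omega⟩, h₃⟩

/-- The exponents of the monomials fixed by `diag(t, t⁻¹, 1)` and, after multiplication by the
`c`-th power of the determinant, by `ζ`. -/
def diagFixed (c : ℕ) (s : Exps) : Prop :=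
  s.i + s.m = s.j + s.l ∧ 4 ∣ s.i + s.j + s.l + s.m + 2 * s.n + 2 * c

/-- Representatives of the orbits of `J` on the fixed monomials that contribute to its
invariants. -/
def orbitRep (s : Exps) : Prop := s.j < s.i ∨ (s.i = s.j ∧ 2 ∣ s.i + s.l)

instance finite_stdExps (z b : ℕ) : Finite (stdExps z b) := by
  refine Finite.of_injective (β := Fin (z + 1) × Fin (z + 1) × Fin (z + 1) × Fin (b + 1)
    × Fin (b + 1) × Fin (b + 1)) (fun s => (⟨s.1.i, ?_⟩, ⟨s.1.j, ?_⟩, ⟨s.1.k, ?_⟩, ⟨s.1.l, ?_⟩,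
      ⟨s.1.m, ?_⟩, ⟨s.1.n, ?_⟩)) ?_
  iterate 6
    obtain ⟨s, ⟨h₁, h₂⟩, h₃⟩ := s
    simp only
    omega
  rintro ⟨s, hs⟩ ⟨s', hs'⟩ h
  simp only [Prod.mk.injEq, Fin.mk.injEq] at h
  exact Subtype.ext (Exps.ext h.1 h.2.1 h.2.2.1 h.2.2.2.1 h.2.2.2.2.1 h.2.2.2.2.2)

/-- A difference of naturals determines its positive and negative parts, one of which is zero. This
matches the standardness condition on the exponents of `xx 2` and `yy 2`. -/
theorem exists_trunc (x y : ℕ) : ∃ k n, (k = 0 ∨ n = 0) ∧ x + k = y + n :=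
  ⟨y - x, x - y, by omega, by omega⟩

/-- The ζ-exponent of the monomial is to be `p + q`; this fixes `n - k`, hence `k` and `n`, and the
degrees `D = i + j`, `E = l + m`. Torus invariance leaves a one-parameter family indexed by `w` from
0 to `min D E`, with `w = q - n - c` equal to `m` if `E ≤ D` and to `j` otherwise. -/
theorem exists_diagFixed {z b c p q : ℕ} (hp : b + c ≤ p) (hp' : p ≤ z + b + c) (hq : c ≤ q)
    (hq' : q ≤ b + c) (h : (p + q) % 4 = 0) :
    ∃ s ∈ stdExps z b, diagFixed c s ∧
      p = s.n + c + (if s.l + s.m ≤ s.i + s.j then s.i + s.j + s.l else s.l + s.m + s.i) ∧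
      q = s.n + c + (if s.l + s.m ≤ s.i + s.j then s.m else s.j) := by
  obtain ⟨k, n, hkn, h'⟩ := exists_trunc (p + q) (2 * c + z + b)
  obtain ⟨D, hD⟩ : ∃ D, D + k = z := ⟨z - k, by omega⟩
  obtain ⟨E, hE⟩ : ∃ E, E + n = b := ⟨b - n, by omega⟩
  obtain ⟨w, hw⟩ : ∃ w, q = n + c + w := ⟨q - n - c, by omega⟩
  rcases le_or_gt E D with hED | hED
  · refine ⟨⟨(D + E - 2 * w) / 2, D - (D + E - 2 * w) / 2, k, E - w, w, n⟩,
      ⟨⟨?_, ?_⟩, hkn⟩, ⟨?_, ?_⟩, ?_, ?_⟩ <;> simp only <;> try rw [if_pos (by omega)]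
    all_goals omega
  · refine ⟨⟨D - w, w, k, (D + E - 2 * w) / 2, E - (D + E - 2 * w) / 2, n⟩,
      ⟨⟨?_, ?_⟩, hkn⟩, ⟨?_, ?_⟩, ?_, ?_⟩ <;> simp only <;> try rw [if_neg (by omega)]
    all_goals omega

/-- On a block with `D + E = 2 * t`, J sends `w` to `min D E - w`, and at a fixed point its sign is
the parity of `t`. So representatives have `2 * w < min D E`, with the midpoint allowed when `t` is
even; equivalently `2 * w + t % 2 ≤ min D E`. That number is `q - n - c`, which makes `p - q`
divisible by 4. -/
theorem exists_diagFixed_orbitRep {z b c p q : ℕ} (hp : b + c ≤ p) (hp' : p ≤ z + b + c)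
    (hq : c ≤ q) (hq' : q ≤ b + c) (h : (p + q) % 4 = 0) (hpq : p % 4 = q % 4) :
    ∃ s ∈ stdExps z b, (diagFixed c s ∧ orbitRep s) ∧
      p + ((if s.l + s.m ≤ s.i + s.j then 2 * s.m else 2 * s.j) + (s.i + s.m) % 2)
        = 2 * (s.i + s.m) + s.n + c ∧
      q = s.n + c + ((if s.l + s.m ≤ s.i + s.j then 2 * s.m else 2 * s.j)
        + (s.i + s.m) % 2) := by
  obtain ⟨k, n, hkn, h'⟩ := exists_trunc (p + q) (2 * c + z + b)
  obtain ⟨D, hD⟩ : ∃ D, D + k = z := ⟨z - k, by omega⟩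
  obtain ⟨E, hE⟩ : ∃ E, E + n = b := ⟨b - n, by omega⟩
  obtain ⟨t, ht⟩ : ∃ t, D + E = 2 * t := ⟨(D + E) / 2, by omega⟩
  obtain ⟨w, hw⟩ : ∃ w, q = n + c + (2 * w + t % 2) := ⟨(q - n - c) / 2, by omega⟩
  rcases le_or_gt E D with hED | hED
  · have hi : t - w + w = t := by omega
    refine ⟨⟨t - w, D - (t - w), k, E - w, w, n⟩,
      ⟨⟨?_, ?_⟩, hkn⟩, ⟨⟨?_, ?_⟩, ?_⟩, ?_, ?_⟩ <;> simp only [orbitRep, hi] <;>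
        try rw [if_pos (by omega)]
    all_goals omega
  · have hi : D - w + (t - (D - w)) = t := by omega
    refine ⟨⟨D - w, w, k, E - (t - (D - w)), t - (D - w), n⟩,
      ⟨⟨?_, ?_⟩, hkn⟩, ⟨⟨?_, ?_⟩, ?_⟩, ?_, ?_⟩ <;> simp only [orbitRep, hi] <;>
        try rw [if_neg (by omega)]
    all_goals omega

theorem mem_Phi24_iff {a b c : ℕ} {x : ℕ × ℕ} : x ∈ Phi24 a b c ↔
    ((b ≤ x.1 ∧ x.1 ≤ a) ∧ c ≤ x.2 ∧ x.2 ≤ b) ∧ (x.1 + x.2) % 4 = 0 := by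
  rw [Phi24, Phi, Finset.mem_filter, Finset.mem_product, Finset.mem_Icc, Finset.mem_Icc]
  rfl

theorem mem_Phi44_iff {a b c : ℕ} {x : ℕ × ℕ} : x ∈ Phi44 a b c ↔
    ((b ≤ x.1 ∧ x.1 ≤ a) ∧ c ≤ x.2 ∧ x.2 ≤ b) ∧ x.1 % 4 = x.2 % 4 ∧ (x.1 + x.2) % 4 = 0 := by
  rw [Phi44, Phi, Finset.mem_filter, Finset.mem_product, Finset.mem_Icc, Finset.mem_Icc]
  rfl

/-- The sum of the two coordinates is the exponent of i in the action of ζ, so blocks of monomials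
with given `k`, `n` correspond to antidiagonals of Φ. -/
theorem card_diagFixed (z b c : ℕ) :
    Nat.card {s : stdExps z b // diagFixed c s.1} = (Phi24 (z + b + c) (b + c) c).card := by
  rw [← Fintype.card_coe, ← Nat.card_eq_fintype_card]
  refine Nat.card_congr (Equiv.ofBijective (fun s => ⟨(s.1.1.n + c
      + (if s.1.1.l + s.1.1.m ≤ s.1.1.i + s.1.1.j then s.1.1.i + s.1.1.j + s.1.1.l
        else s.1.1.l + s.1.1.m + s.1.1.i),
      s.1.1.n + c + (if s.1.1.l + s.1.1.m ≤ s.1.1.i + s.1.1.j then s.1.1.m else s.1.1.j)),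
        mem_Phi24_iff.2 ?_⟩) ⟨?_, ?_⟩)
  · obtain ⟨⟨⟨i, j, k, l, m, n⟩, ⟨h₁, h₂⟩, h₃⟩, h₄, h₅⟩ := s
    simp only at h₁ h₂ h₃ h₄ h₅ ⊢
    split_ifs <;> omega
  · rintro ⟨⟨⟨i, j, k, l, m, n⟩, ⟨h₁, h₂⟩, h₃⟩, h₄, h₅⟩
      ⟨⟨⟨i', j', k', l', m', n'⟩, ⟨h₁', h₂'⟩, h₃'⟩, h₄', h₅'⟩ h
    simp only at h₁ h₂ h₃ h₄ h₅ h₁' h₂' h₃' h₄' h₅'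
    simp only [Subtype.mk.injEq, Prod.mk.injEq] at h
    obtain ⟨h, h'⟩ := h
    have hk : k = k' ∧ n = n' := by
      split_ifs at h h' <;> omega
    obtain ⟨rfl, rfl⟩ := hk
    apply Subtype.ext
    apply Subtype.ext
    split_ifs at h h' <;> refine Exps.ext ?_ ?_ rfl ?_ ?_ rfl <;> simp only <;> omega
  · rintro ⟨⟨p, q⟩, hx⟩
    obtain ⟨⟨hp, hq⟩, hpq⟩ := mem_Phi24_iff.1 hx
    obtain ⟨s, hs, hf, h₁, h₂⟩ := exists_diagFixed hp.1 hp.2 hq.1 hq.2 hpq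
    exact ⟨⟨⟨s, hs⟩, hf⟩, Subtype.ext (Prod.ext h₁.symm h₂.symm)⟩

-- Along an antidiagonal, pairs with `p - q` divisible by 4 are every second pair, as J-orbits are
-- about half of the monomials of a block.
set_option maxHeartbeats 1000000 in
theorem card_diagFixed_orbitRep (z b c : ℕ) :
    Nat.card {s : stdExps z b // diagFixed c s.1 ∧ orbitRep s.1}
      = (Phi44 (z + b + c) (b + c) c).card := by
  rw [← Fintype.card_coe, ← Nat.card_eq_fintype_card]
  refine Nat.card_congr (Equiv.ofBijective (fun s => ⟨(2 * (s.1.1.i + s.1.1.m) + s.1.1.n + c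
      - ((if s.1.1.l + s.1.1.m ≤ s.1.1.i + s.1.1.j then 2 * s.1.1.m else 2 * s.1.1.j)
        + (s.1.1.i + s.1.1.m) % 2),
      s.1.1.n + c + ((if s.1.1.l + s.1.1.m ≤ s.1.1.i + s.1.1.j then 2 * s.1.1.m
        else 2 * s.1.1.j) + (s.1.1.i + s.1.1.m) % 2)), mem_Phi44_iff.2 ?_⟩) ⟨?_, ?_⟩)
  · obtain ⟨⟨⟨i, j, k, l, m, n⟩, ⟨h₁, h₂⟩, h₃⟩, ⟨h₄, h₅⟩, h₆⟩ := s
    simp only [orbitRep] at h₁ h₂ h₃ h₄ h₅ h₆ ⊢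
    split_ifs <;> omega
  · rintro ⟨⟨⟨i, j, k, l, m, n⟩, ⟨h₁, h₂⟩, h₃⟩, ⟨h₄, h₅⟩, h₆⟩
      ⟨⟨⟨i', j', k', l', m', n'⟩, ⟨h₁', h₂'⟩, h₃'⟩, ⟨h₄', h₅'⟩, h₆'⟩ h
    simp only [orbitRep] at h₁ h₂ h₃ h₄ h₅ h₆ h₁' h₂' h₃' h₄' h₅' h₆'
    simp only [Subtype.mk.injEq, Prod.mk.injEq] at h
    obtain ⟨h, h'⟩ := h
    -- This bound shows that the subtraction in the first coordinate does not truncate; adding the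
    -- coordinates then recovers `i + m + n`, hence `n - k`.
    have hw : (if l + m ≤ i + j then 2 * m else 2 * j) ≤ i + m := by split_ifs <;> omega
    have hw' : (if l' + m' ≤ i' + j' then 2 * m' else 2 * j') ≤ i' + m' := by split_ifs <;> omega
    have hk : i + m + n = i' + m' + n' := by
      generalize (if l + m ≤ i + j then 2 * m else 2 * j) = w at *
      generalize (if l' + m' ≤ i' + j' then 2 * m' else 2 * j') = w' at *
      clear h₁ h₂ h₃ h₄ h₅ h₆ h₁' h₂' h₃' h₄' h₅' h₆'
      omega
    have hk : k = k' ∧ n = n' := by omega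
    obtain ⟨rfl, rfl⟩ := hk
    have hi : i + m = i' + m' := by omega
    have hij : i + j = i' + j' := by omega
    have hlm : l + m = l' + m' := by omega
    rw [hi, hij, hlm] at h'
    apply Subtype.ext
    apply Subtype.ext
    change Exps.mk i j k l m n = Exps.mk i' j' k l' m' n
    clear h h₁ h₂ h₃ h₅ h₆ h₁' h₂' h₃' h₅' h₆'
    have hmj : m = m' ∨ j = j' := by
      split_ifs at h'
      · exact Or.inl (by omega)
      · exact Or.inr (by omega)
    clear h'
    rcases hmj with rfl | rfl <;> refine Exps.ext ?_ ?_ rfl ?_ ?_ rfl <;> simp only <;> omega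
  · rintro ⟨⟨p, q⟩, hx⟩
    obtain ⟨⟨hp, hq⟩, hpq, hpq'⟩ := mem_Phi44_iff.1 hx
    obtain ⟨s, hs, hf, h₁, h₂⟩ := exists_diagFixed_orbitRep hp.1 hp.2 hq.1 hq.2 hpq' hpq
    exact ⟨⟨⟨s, hs⟩, hf⟩, Subtype.ext (Prod.ext (Nat.sub_eq_of_eq_add h₁.symm) h₂.symm)⟩

/-! ### Invariants of a signed permutation of a basis -/

/-- The dimension of the space of vectors that are supported in a given part of a basis and
are invariant under a signed permutation of that part, in terms of orbit representatives. -/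
theorem finrank_eq_card_orbitRep {S V : Type*} [Finite S] [AddCommGroup V] [Module ℂ V]
    (b : Module.Basis S ℂ V) (W : Submodule ℂ V) (F R : S → Prop) (τ : S → S) (σ : S → ℂ)
    (hτ : ∀ s, τ (τ s) = s) (hF : ∀ s, F s → F (τ s)) (hσ : ∀ s, F s → σ s * σ (τ s) = 1)
    (hW : ∀ v, v ∈ W ↔ (∀ s, ¬ F s → b.repr v s = 0)
      ∧ ∀ s, F s → b.repr v (τ s) = σ s * b.repr v s)
    (hRF : ∀ s, R s → F s) (h₁ : ∀ s, R s → R (τ s) → τ s = s ∧ σ s = 1)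
    (h₂ : ∀ s, F s → ¬ R s → ¬ R (τ s) → τ s = s ∧ σ s ≠ 1) :
    Module.finrank ℂ W = Nat.card {s // R s} := by
  classical
  have := Fintype.ofFinite S
  let L : W →ₗ[ℂ] ({s // R s} → ℂ) :=
    { toFun := fun v s => b.repr v.1 s.1
      map_add' := fun v w => by ext s; simp
      map_smul' := fun a v => by ext s; simp }
  have hL : ∀ (v : W) s, L v s = b.repr v.1 s.1 := fun v s => rfl
  have hbij : Function.Bijective L := by
    constructor
    · rw [← LinearMap.ker_eq_bot, LinearMap.ker_eq_bot']
      rintro ⟨v, hv⟩ h0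
      apply Subtype.ext
      have hv' := (hW v).1 hv
      have hR : ∀ s, R s → b.repr v s = 0 := fun s hs => congrFun h0 ⟨s, hs⟩
      refine b.repr.map_eq_zero_iff.1 (Finsupp.ext fun s => ?_)
      rw [Finsupp.zero_apply]
      by_cases hFs : F s
      swap
      · exact hv'.1 s hFs
      by_cases hRs : R s
      · exact hR s hRs
      by_cases hRs' : R (τ s)
      · have h3 := hv'.2 (τ s) (hF s hFs)
        rw [hτ, hR _ hRs', mul_zero] at h3
        exact h3
      · obtain ⟨h3, h4⟩ := h₂ s hFs hRs hRs'
        have h5 := hv'.2 s hFs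
        rw [h3] at h5
        have h6 : (σ s - 1) * b.repr v s = 0 := by rw [sub_mul, one_mul, ← h5, sub_self]
        exact (mul_eq_zero.1 h6).resolve_left (sub_ne_zero.2 h4)
    · intro g
      -- The coordinates prescribed on representatives are carried to their partners by the sign;
      -- orbits without a representative receive zero.
      let f : S → ℂ := fun s => if h : R s then g ⟨s, h⟩ else
        if h : R (τ s) then σ (τ s) * g ⟨τ s, h⟩ else 0
      have hf : ∀ s, b.repr (b.equivFun.symm f) s = f s := fun s => by
        rw [← b.equivFun_apply, LinearEquiv.apply_symm_apply]
      refine ⟨⟨b.equivFun.symm f, (hW _).2 ⟨fun s hs => ?_, fun s hs => ?_⟩⟩, ?_⟩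
      · rw [hf]
        simp only [f]
        rw [dif_neg fun h => hs (hRF s h), dif_neg fun h => hs (by
          have := hF _ (hRF _ h)
          rwa [hτ] at this)]
      · rw [hf, hf]
        simp only [f, hτ]
        by_cases hRs : R s
        · by_cases hRs' : R (τ s)
          · obtain ⟨h3, h4⟩ := h₁ s hRs hRs'
            simp only [h3, h4, one_mul]
          · rw [dif_neg hRs', dif_pos hRs, dif_pos hRs]
        · by_cases hRs' : R (τ s)
          · rw [dif_pos hRs', dif_neg hRs, dif_pos hRs', ← mul_assoc, hσ s hs, one_mul]
          · rw [dif_neg hRs', dif_neg hRs, dif_neg hRs, dif_neg hRs', mul_zero]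
      · funext s
        rw [hL, hf]
        simp only [f]
        rw [dif_pos s.2]
  rw [(LinearEquiv.ofBijective L hbij).finrank_eq, Module.finrank_fintype_fun_eq_card,
    Nat.card_eq_fintype_card]

/-- Coordinates of the image of a vector under a signed permutation of a basis. -/
theorem repr_of_signed_perm {S V : Type*} [AddCommGroup V] [Module ℂ V]
    (b : Module.Basis S ℂ V) (L : V →ₗ[ℂ] V) (τ : S → S) (σ : S → ℂ) (hτ : ∀ s, τ (τ s) = s)
    (hL : ∀ s, L (b s) = σ s • b (τ s)) (v : V) (s : S) :
    b.repr (L v) (τ s) = σ s * b.repr v s := by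
  have h : (Finsupp.lapply (τ s)).comp (b.repr.toLinearMap.comp L)
      = (σ s) • (Finsupp.lapply s).comp b.repr.toLinearMap := by
    refine b.ext fun s' => ?_
    simp only [LinearMap.comp_apply, hL, map_smul, LinearEquiv.coe_coe, Module.Basis.repr_self,
      Finsupp.lapply_apply, LinearMap.smul_apply, smul_eq_mul]
    by_cases hs : s' = s
    · subst hs; simp
    · rw [Finsupp.single_eq_of_ne (Ne.symm hs), Finsupp.single_eq_of_ne, mul_zero, mul_zero]
      intro h
      apply hs
      rw [← hτ s', ← h, hτ]
  exact LinearMap.congr_fun h v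

theorem map_eq_self_iff_of_signed_perm {S V : Type*} [AddCommGroup V] [Module ℂ V]
    (b : Module.Basis S ℂ V) (L : V →ₗ[ℂ] V) (τ : S → S) (σ : S → ℂ) (hτ : ∀ s, τ (τ s) = s)
    (hL : ∀ s, L (b s) = σ s • b (τ s)) (v : V) :
    L v = v ↔ ∀ s, b.repr v (τ s) = σ s * b.repr v s := by
  constructor
  · intro h s
    rw [← repr_of_signed_perm b L τ σ hτ hL, h]
  · intro h
    apply b.repr.injective
    ext s
    have h₁ := repr_of_signed_perm b L τ σ hτ hL v (τ s)
    have h₂ := h (τ s)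
    rw [hτ] at h₁ h₂
    rw [h₁, ← h₂]

/-- If a polynomial with coefficients in an algebra takes values in a subspace at all real
points, then its coefficients lie in this subspace. -/
theorem coeff_mem_of_forall_eval_mem {A : Type*} [CommRing A] [Algebra ℂ A]
    (V : Submodule ℂ A) (P : Polynomial A)
    (h : ∀ t : ℝ, P.eval (algebraMap ℂ A t) ∈ V) (n : ℕ) : P.coeff n ∈ V := by
  by_contra hn
  -- A functional that kills `V` but not the given coefficient turns `P` into a complex polynomial
  -- vanishing at every real number, hence zero.
  obtain ⟨f, hf, hV⟩ := Submodule.exists_le_ker_of_notMem hn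
  let Q : Polynomial ℂ := ∑ k ∈ P.support, Polynomial.monomial k (f (P.coeff k))
  have hQ : ∀ k, Q.coeff k = f (P.coeff k) := fun k => by
    simp only [Q, Polynomial.finsetSum_coeff, Polynomial.coeff_monomial]
    rw [Finset.sum_ite_eq']
    split_ifs with hk
    · rfl
    · rw [Polynomial.notMem_support_iff.1 hk, map_zero]
  have hQ0 : Q = 0 := by
    refine Polynomial.eq_zero_of_infinite_isRoot Q
      ((Set.infinite_range_of_injective Complex.ofReal_injective).mono ?_)
    rintro _ ⟨t, rfl⟩
    have h₁ := hV (h t)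
    rw [LinearMap.mem_ker, Polynomial.eval_eq_sum, Polynomial.sum, map_sum] at h₁
    simp only [Set.mem_ofPred_eq, Polynomial.IsRoot, Q, Polynomial.eval_finsetSum,
      Polynomial.eval_monomial]
    rw [← h₁]
    refine Finset.sum_congr rfl fun k _ => ?_
    rw [← map_pow, mul_comm (P.coeff k), ← Algebra.smul_def, map_smul, smul_eq_mul, mul_comm]
  apply hf
  rw [← hQ, hQ0, Polynomial.coeff_zero]

/-! ### The infinitesimal action on polynomial functions -/

section Infinitesimal

variable {g : ℕ}

/-- The entry of the generic matrix times `A` at position `p`. -/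
noncomputable def mulEntry (A : Matrix (Fin g) (Fin g) ℂ) (p : Fin g × Fin g) : MatPoly g :=
  ∑ k : Fin g, C (A k p.2) * X (p.1, k)

theorem mulEntry_add (A B : Matrix (Fin g) (Fin g) ℂ) (p : Fin g × Fin g) :
    mulEntry (A + B) p = mulEntry A p + mulEntry B p := by
  simp [mulEntry, add_mul, Finset.sum_add_distrib]

theorem mulEntry_smul (a : ℂ) (A : Matrix (Fin g) (Fin g) ℂ) (p : Fin g × Fin g) :
    mulEntry (a • A) p = C a * mulEntry A p := by
  simp [mulEntry, Finset.mul_sum, mul_assoc]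

theorem mulEntry_one (p : Fin g × Fin g) : mulEntry (1 : Matrix (Fin g) (Fin g) ℂ) p = X p := by
  simp [mulEntry, Matrix.one_apply]

theorem rightMul_X (A : Matrix (Fin g) (Fin g) ℂ) (p : Fin g × Fin g) :
    rightMul g A (X p) = mulEntry A p :=
  aeval_X _ _

/-- The derivation `f ↦ d/dt f(x (1 + t A))` at `t = 0`. -/
noncomputable def infAction (A : Matrix (Fin g) (Fin g) ℂ) :
    Derivation ℂ (MatPoly g) (MatPoly g) :=
  mkDerivation ℂ fun p => mulEntry A p

theorem infAction_X (A : Matrix (Fin g) (Fin g) ℂ) (p : Fin g × Fin g) :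
    infAction A (X p) = mulEntry A p :=
  mkDerivation_X _ _ _

theorem infAction_add (A B : Matrix (Fin g) (Fin g) ℂ) :
    infAction (A + B) = infAction A + infAction B := by
  refine derivation_ext fun p => ?_
  simp [infAction_X, mulEntry_add]

theorem infAction_smul (a : ℂ) (A : Matrix (Fin g) (Fin g) ℂ) :
    infAction (a • A) = a • infAction A := by
  refine derivation_ext fun p => ?_
  simp [infAction_X, mulEntry_smul, smul_eq_C_mul]

/-- The substitution `x ↦ x ((1 + t²) + 2 t A + 2 t² A²)`. -/
noncomputable def cayleySubst (A : Matrix (Fin g) (Fin g) ℂ) :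
    MatPoly g →ₐ[ℂ] Polynomial (MatPoly g) :=
  aeval fun p => Polynomial.C (X p) + Polynomial.X * Polynomial.C (2 * mulEntry A p)
    + Polynomial.X ^ 2 * Polynomial.C (X p + 2 * mulEntry (A * A) p)

/-- When A³ = -A, this matrix is 1 + t² times the Cayley transform (1 + tA)(1 - tA)⁻¹, which is
unitary for real t and skew-Hermitian A. Being polynomial in t, the family can be differentiated by
reading off a coefficient; the cleared denominator is why stability under scalar multiples is
needed. -/
theorem eval_cayleySubst (A : Matrix (Fin g) (Fin g) ℂ) (t : ℂ) (f : MatPoly g) :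
    (cayleySubst A f).eval (algebraMap ℂ (MatPoly g) t)
      = rightMul g ((1 + t ^ 2) • 1 + (2 * t) • A + (2 * t ^ 2) • (A * A)) f := by
  have h : ((Polynomial.evalRingHom (algebraMap ℂ (MatPoly g) t)).comp
      (cayleySubst A : MatPoly g →+* Polynomial (MatPoly g)))
      = (rightMul g ((1 + t ^ 2) • 1 + (2 * t) • A + (2 * t ^ 2) • (A * A)) :
        MatPoly g →+* MatPoly g) := by
    refine MvPolynomial.ringHom_ext (fun a => ?_) fun p => ?_
    · simp [cayleySubst, rightMul, Polynomial.algebraMap_apply, algebraMap_eq]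
    · simp only [RingHom.comp_apply, RingHom.coe_coe, rightMul_X, mulEntry_add, mulEntry_smul,
        mulEntry_one, cayleySubst, aeval_X, Polynomial.coe_evalRingHom, Polynomial.eval_add,
        Polynomial.eval_mul, Polynomial.eval_pow, Polynomial.eval_C, Polynomial.eval_X,
        algebraMap_eq, C_add, C_mul, C_pow, C_1, show (C 2 : MatPoly g) = 2 from rfl]
      ring
  exact congrArg (fun φ : MatPoly g →+* MatPoly g => φ f) h

theorem coeff_cayleySubst (A : Matrix (Fin g) (Fin g) ℂ) (f : MatPoly g) :
    (cayleySubst A f).coeff 0 = f ∧ (cayleySubst A f).coeff 1 = 2 * infAction A f := by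
  induction f using MvPolynomial.induction_on with
  | C a =>
    have h : cayleySubst A (C a) = Polynomial.C (C a) := by
      simp [cayleySubst, Polynomial.algebraMap_apply, algebraMap_eq]
    rw [h, Polynomial.coeff_C_zero, Polynomial.coeff_C, if_neg one_ne_zero]
    simp [infAction]
  | add p q hp hq =>
    simp only [map_add, Polynomial.coeff_add, hp.1, hp.2, hq.1, hq.2, true_and]
    ring
  | mul_X p i hp =>
    have h₀ : (cayleySubst A (X i)).coeff 0 = X i := by
      simp [cayleySubst]
    have h₁ : (cayleySubst A (X i)).coeff 1 = 2 * infAction A (X i) := by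
      rw [infAction_X, cayleySubst, aeval_X]
      generalize (2 * mulEntry A i) = y
      simp [Polynomial.coeff_X_pow_mul', Polynomial.coeff_C]
    rw [map_mul, Polynomial.mul_coeff_zero, Polynomial.mul_coeff_one, hp.1, hp.2, h₀, h₁,
      Derivation.leibniz]
    refine ⟨rfl, ?_⟩
    simp only [smul_eq_mul]
    ring

/-- A subspace stable under the scalar multiples of unitary matrices is stable under the
skew-Hermitian matrices with `A³ = -A`. -/
theorem infAction_mem_of_skew (V : Submodule ℂ (MatPoly g))
    (hV : ∀ (a : ℂ) (u : U g), ∀ f ∈ V, rightMul g (a • (u : Matrix (Fin g) (Fin g) ℂ)) f ∈ V)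
    (A : Matrix (Fin g) (Fin g) ℂ) (hA : star A = -A) (hA' : A * A * A = -A) {f : MatPoly g}
    (hf : f ∈ V) : infAction A f ∈ V := by
  have h : (cayleySubst A f).coeff 1 ∈ V := by
    refine coeff_mem_of_forall_eval_mem V _ (fun t => ?_) 1
    rw [eval_cayleySubst]
    set M : Matrix (Fin g) (Fin g) ℂ :=
      (1 + (t : ℂ) ^ 2) • 1 + (2 * (t : ℂ)) • A + (2 * (t : ℂ) ^ 2) • (A * A) with hM
    have ht : (1 + (t : ℂ) ^ 2) ≠ 0 := by
      have : (1 + t ^ 2 : ℝ) ≠ 0 := by positivity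
      exact_mod_cast this
    have hA4 : A * A * (A * A) = -(A * A) := by
      rw [← mul_assoc, hA', neg_mul]
    have hstar : star M = (1 + (t : ℂ) ^ 2) • 1 - (2 * (t : ℂ)) • A
        + (2 * (t : ℂ) ^ 2) • (A * A) := by
      rw [hM]
      simp only [star_add, star_smul, star_mul, hA, star_one, neg_mul_neg, Complex.star_def,
        map_pow, Complex.conj_ofReal, map_ofNat, smul_neg, sub_eq_add_neg,
        mul_comm _ (2 : ℂ)]
    have hMM : M * star M = ((1 + (t : ℂ) ^ 2) ^ 2) • 1 := by
      rw [hstar, hM]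
      simp only [add_mul, mul_add, mul_sub, smul_mul_smul_comm, one_mul, mul_one, hA4,
        ← mul_assoc, hA']
      module
    have hu : (1 + (t : ℂ) ^ 2)⁻¹ • M ∈ Matrix.unitaryGroup (Fin g) ℂ := by
      rw [Matrix.mem_unitaryGroup_iff, star_smul, smul_mul_smul_comm, hMM, smul_smul]
      have : star (1 + (t : ℂ) ^ 2)⁻¹ = (1 + (t : ℂ) ^ 2)⁻¹ := by
        simp
      rw [this, show (1 + (t : ℂ) ^ 2)⁻¹ * (1 + (t : ℂ) ^ 2)⁻¹ * (1 + (t : ℂ) ^ 2) ^ 2 = 1 by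
        field_simp, one_smul]
    have h := hV (1 + (t : ℂ) ^ 2) ⟨_, hu⟩ f hf
    simp only at h
    rwa [smul_smul, mul_inv_cancel₀ ht, one_smul] at h
  rw [(coeff_cayleySubst A f).2] at h
  have h₂ := V.smul_mem (1 / 2 : ℂ) h
  rwa [smul_eq_C_mul, ← mul_assoc, show (2 : MatPoly g) = C 2 from rfl, ← C_mul,
    show (1 / 2 : ℂ) * 2 = 1 by norm_num, C_1, one_mul] at h₂

/-- Stability under the elementary matrices off the diagonal. -/
theorem infAction_single_mem (V : Submodule ℂ (MatPoly g))
    (hV : ∀ (a : ℂ) (u : U g), ∀ f ∈ V, rightMul g (a • (u : Matrix (Fin g) (Fin g) ℂ)) f ∈ V)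
    {p q : Fin g} (hpq : p ≠ q) {f : MatPoly g} (hf : f ∈ V) :
    infAction (Matrix.single p q 1) f ∈ V := by
  -- For unimodular `w` this matrix is skew-Hermitian, and its square is minus the projection onto
  -- the coordinates `p`, `q`, so its cube is its negative.
  have key : ∀ w : ℂ, w * star w = 1 →
      infAction (Matrix.single p q w - Matrix.single q p (star w)) f ∈ V := by
    intro w hw
    have hw' : star w * w = 1 := by rw [mul_comm, hw]
    refine infAction_mem_of_skew V hV _ ?_ ?_ hf
    · simp [Matrix.star_eq_conjTranspose, Matrix.conjTranspose_single]
    · simp only [sub_mul, mul_sub, Matrix.single_mul_single_same,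
        Matrix.single_mul_single_of_ne _ _ _ _ hpq, Matrix.single_mul_single_of_ne _ _ _ _ hpq.symm,
        hw, hw', one_mul]
      simp [neg_add_eq_sub]
  have h₁ := key 1 (by simp)
  have h₂ := key Complex.I (by simp)
  -- The cases `w = 1` and `w = i` give the difference of the two matrix units and i times their
  -- sum; a complex combination isolates one of them.
  have h : infAction (Matrix.single p q 1) f
      = (1 / 2 : ℂ) • infAction (Matrix.single p q 1 - Matrix.single q p (star 1)) f
        + (-Complex.I / 2) • infAction (Matrix.single p q Complex.I
          - Matrix.single q p (star Complex.I)) f := by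
    rw [← Derivation.smul_apply, ← Derivation.smul_apply, ← Derivation.add_apply,
      ← infAction_smul, ← infAction_smul, ← infAction_add]
    congr 2
    have e₁ : -Complex.I / 2 * Complex.I = 1 / 2 := by
      rw [div_mul_eq_mul_div, neg_mul, Complex.I_mul_I, neg_neg]
    have e₂ : -Complex.I / 2 * star Complex.I = -(1 / 2) := by
      rw [Complex.star_def, Complex.conj_I, mul_neg, e₁]
    rw [smul_sub, smul_sub, Matrix.smul_single, Matrix.smul_single, Matrix.smul_single,
      Matrix.smul_single, smul_eq_mul, smul_eq_mul, smul_eq_mul, smul_eq_mul, e₁, e₂, star_one,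
      mul_one, ← Matrix.single_neg, sub_neg_eq_add, sub_add_add_cancel, ← Matrix.single_add]
    norm_num
  rw [h]
  exact V.add_mem (V.smul_mem _ h₁) (V.smul_mem _ h₂)

end Infinitesimal

/-! ### The monomials in the entries of the first row and the minors of the first two rows -/

noncomputable section

/-- The entries of the first row. -/
def xx (i : Fin 3) : MatPoly 3 := X (0, i)

/-- The signed minors of the first two rows. -/
def yy : Fin 3 → MatPoly 3 :=
  ![X (0, 1) * X (1, 2) - X (0, 2) * X (1, 1), X (0, 2) * X (1, 0) - X (0, 0) * X (1, 2),
    X (0, 0) * X (1, 1) - X (0, 1) * X (1, 0)]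

/-- The determinant. -/
def dd : MatPoly 3 := (Matrix.of fun i j => (X (i, j) : MatPoly 3)).det

/-- The monomials spanning the representation. -/
def mono (c : ℕ) (s : Exps) : MatPoly 3 :=
  dd ^ c * (xx 0 ^ s.i * xx 1 ^ s.j * xx 2 ^ s.k * (yy 0 ^ s.l * yy 1 ^ s.m * yy 2 ^ s.n))

theorem dd_eq : dd = X (2, 0) * yy 0 + X (2, 1) * yy 1 + X (2, 2) * yy 2 := by
  simp only [dd, Matrix.det_fin_three, Matrix.of_apply, yy, Matrix.cons_val]
  ring

/-- This is the Laplace expansion of a determinant with a repeated row. -/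
theorem xx_mul_yy : xx 0 * yy 0 + xx 1 * yy 1 + xx 2 * yy 2 = 0 := by
  simp only [xx, yy, Matrix.cons_val]
  ring

theorem infAction_single_X (p q : Fin 3) (i j : Fin 3) :
    infAction (Matrix.single p q (1 : ℂ)) (X (i, j) : MatPoly 3)
      = if q = j then X (i, p) else 0 := by
  rw [infAction_X, mulEntry, Finset.sum_eq_single p]
  · by_cases h : q = j
    · subst h; simp
    · rw [if_neg h, Matrix.single_apply_of_ne]
      · simp
      · simp [h]
  · intro k _ hk
    rw [Matrix.single_apply_of_ne]
    · simp
    · simp [hk.symm]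
  · simp

/-- The matrix unit at (p, q) sends `xx q` to `xx p` and, dually, `yy p` to `-yy q`. It kills `dd`,
since its trace is zero. -/
theorem infAction_one_zero :
    infAction (Matrix.single 1 0 (1 : ℂ)) (xx 0) = xx 1 ∧
    infAction (Matrix.single 1 0 (1 : ℂ)) (xx 1) = 0 ∧
    infAction (Matrix.single 1 0 (1 : ℂ)) (xx 2) = 0 ∧
    infAction (Matrix.single 1 0 (1 : ℂ)) (yy 0) = 0 ∧
    infAction (Matrix.single 1 0 (1 : ℂ)) (yy 1) = -yy 0 ∧
    infAction (Matrix.single 1 0 (1 : ℂ)) (yy 2) = 0 ∧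
    infAction (Matrix.single 1 0 (1 : ℂ)) dd = 0 := by
  have h₀ : infAction (Matrix.single 1 0 (1 : ℂ)) (yy 0) = 0 := by
    simp [yy, infAction_single_X]
  have h₁ : infAction (Matrix.single 1 0 (1 : ℂ)) (yy 1) = -yy 0 := by
    simp [yy, infAction_single_X]; ring
  have h₂ : infAction (Matrix.single 1 0 (1 : ℂ)) (yy 2) = 0 := by
    simp [yy, infAction_single_X]; ring
  refine ⟨?_, ?_, ?_, h₀, h₁, h₂, ?_⟩
  · simp [xx, infAction_single_X]
  · simp [xx, infAction_single_X]
  · simp [xx, infAction_single_X]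
  · simp [dd_eq, h₀, h₁, h₂, infAction_single_X]; ring

theorem infAction_two_zero :
    infAction (Matrix.single 2 0 (1 : ℂ)) (xx 0) = xx 2 ∧
    infAction (Matrix.single 2 0 (1 : ℂ)) (xx 1) = 0 ∧
    infAction (Matrix.single 2 0 (1 : ℂ)) (xx 2) = 0 ∧
    infAction (Matrix.single 2 0 (1 : ℂ)) (yy 0) = 0 ∧
    infAction (Matrix.single 2 0 (1 : ℂ)) (yy 1) = 0 ∧
    infAction (Matrix.single 2 0 (1 : ℂ)) (yy 2) = -yy 0 ∧
    infAction (Matrix.single 2 0 (1 : ℂ)) dd = 0 := by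
  have h₀ : infAction (Matrix.single 2 0 (1 : ℂ)) (yy 0) = 0 := by
    simp [yy, infAction_single_X]
  have h₁ : infAction (Matrix.single 2 0 (1 : ℂ)) (yy 1) = 0 := by
    simp [yy, infAction_single_X]; ring
  have h₂ : infAction (Matrix.single 2 0 (1 : ℂ)) (yy 2) = -yy 0 := by
    simp [yy, infAction_single_X]; ring
  refine ⟨?_, ?_, ?_, h₀, h₁, h₂, ?_⟩
  · simp [xx, infAction_single_X]
  · simp [xx, infAction_single_X]
  · simp [xx, infAction_single_X]
  · simp [dd_eq, h₀, h₁, h₂, infAction_single_X]; ring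

theorem infAction_two_one :
    infAction (Matrix.single 2 1 (1 : ℂ)) (xx 0) = 0 ∧
    infAction (Matrix.single 2 1 (1 : ℂ)) (yy 2) = -yy 1 ∧
    infAction (Matrix.single 2 1 (1 : ℂ)) (yy 1) = 0 ∧
    infAction (Matrix.single 2 1 (1 : ℂ)) dd = 0 := by
  have h₀ : infAction (Matrix.single 2 1 (1 : ℂ)) (yy 0) = 0 := by
    simp [yy, infAction_single_X]; ring
  have h₁ : infAction (Matrix.single 2 1 (1 : ℂ)) (yy 1) = 0 := by
    simp [yy, infAction_single_X]
  have h₂ : infAction (Matrix.single 2 1 (1 : ℂ)) (yy 2) = -yy 1 := by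
    simp [yy, infAction_single_X]; ring
  refine ⟨?_, h₂, h₁, ?_⟩
  · simp [xx, infAction_single_X]
  · simp [dd_eq, h₀, h₁, h₂, infAction_single_X]; ring

theorem infAction_one_zero_mono (c i j k l m n : ℕ) :
    infAction (Matrix.single 1 0 (1 : ℂ)) (mono c ⟨i, j, k, l, m, n⟩)
      = (i : ℂ) • mono c ⟨i - 1, j + 1, k, l, m, n⟩
        - (m : ℂ) • mono c ⟨i, j, k, l + 1, m - 1, n⟩ := by
  obtain ⟨h₁, h₂, h₃, h₄, h₅, h₆, h₇⟩ := infAction_one_zero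
  simp only [mono, Derivation.leibniz, Derivation.leibniz_pow, h₁, h₂, h₃, h₄, h₅, h₆, h₇,
    smul_eq_mul, nsmul_eq_mul, Nat.cast_smul_eq_nsmul, pow_succ]
  ring

theorem infAction_two_zero_mono (c i j k l m n : ℕ) :
    infAction (Matrix.single 2 0 (1 : ℂ)) (mono c ⟨i, j, k, l, m, n⟩)
      = (i : ℂ) • mono c ⟨i - 1, j, k + 1, l, m, n⟩
        - (n : ℂ) • mono c ⟨i, j, k, l + 1, m, n - 1⟩ := by
  obtain ⟨h₁, h₂, h₃, h₄, h₅, h₆, h₇⟩ := infAction_two_zero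
  simp only [mono, Derivation.leibniz, Derivation.leibniz_pow, h₁, h₂, h₃, h₄, h₅, h₆, h₇,
    smul_eq_mul, nsmul_eq_mul, Nat.cast_smul_eq_nsmul, pow_succ]
  ring

theorem infAction_two_one_mono (c i m n : ℕ) :
    infAction (Matrix.single 2 1 (1 : ℂ)) (mono c ⟨i, 0, 0, 0, m, n + 1⟩)
      = (-(n + 1 : ℂ)) • mono c ⟨i, 0, 0, 0, m + 1, n⟩ := by
  obtain ⟨h₁, h₂, h₃, h₄⟩ := infAction_two_one
  have h : (-(n + 1 : ℂ)) • mono c ⟨i, 0, 0, 0, m + 1, n⟩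
      = -((n + 1 : ℕ) • mono c ⟨i, 0, 0, 0, m + 1, n⟩) := by
    rw [neg_smul, ← Nat.cast_smul_eq_nsmul ℂ]; push_cast; rfl
  rw [h]
  simp only [mono, Derivation.leibniz, Derivation.leibniz_pow, h₁, h₂, h₃, h₄, pow_zero, mul_one,
    one_mul, smul_eq_mul, nsmul_eq_mul, Nat.add_sub_cancel]
  ring

theorem mono_relation (c i j k l m n : ℕ) :
    mono c ⟨i + 1, j, k, l + 1, m, n⟩ + mono c ⟨i, j + 1, k, l, m + 1, n⟩
      + mono c ⟨i, j, k + 1, l, m, n + 1⟩ = 0 := by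
  have h : mono c ⟨i + 1, j, k, l + 1, m, n⟩ + mono c ⟨i, j + 1, k, l, m + 1, n⟩
      + mono c ⟨i, j, k + 1, l, m, n + 1⟩
      = mono c ⟨i, j, k, l, m, n⟩ * (xx 0 * yy 0 + xx 1 * yy 1 + xx 2 * yy 2) := by
    simp only [mono]; ring
  rw [h, xx_mul_yy, mul_zero]

end

noncomputable section

/-! ### Generation of all monomials from the highest weight vector -/

section Generation

/-- Stability under the infinitesimal action of the elementary matrices off the diagonal. -/
def OffDiagStable (V : Submodule ℂ (MatPoly 3)) : Prop :=
  ∀ p q : Fin 3, p ≠ q → ∀ f ∈ V, infAction (Matrix.single p q (1 : ℂ)) f ∈ V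

variable {V : Submodule ℂ (MatPoly 3)}

theorem mem_of_smul_mem {a : ℂ} (ha : a ≠ 0) {f : MatPoly 3} (h : a • f ∈ V) : f ∈ V :=
  (V.smul_mem_iff ha).1 h

theorem mono_mem_of_top (hV : OffDiagStable V) {c z : ℕ} (m n : ℕ) (h : mono c ⟨z, 0, 0, 0, 0, m + n⟩ ∈ V) :
    mono c ⟨z, 0, 0, 0, m, n⟩ ∈ V := by
  induction m generalizing n with
  | zero => rwa [zero_add] at h
  | succ m ih =>
    have h₁ := hV 2 1 (by decide) _ (ih (n + 1) (by rwa [← add_assoc, add_right_comm]))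
    rw [infAction_two_one_mono] at h₁
    refine mem_of_smul_mem ?_ h₁
    rw [neg_ne_zero]
    exact_mod_cast Nat.succ_ne_zero n

/-- Two monomials whose images under the lowering operators form an invertible system. -/
theorem mem_of_two_by_two {u v : MatPoly 3} {a p q : ℕ} (ha : 0 < a)
    (h₁ : ((a + p : ℕ) : ℂ) • u + (p : ℂ) • v ∈ V)
    (h₂ : ((a + q : ℕ) : ℂ) • v + (q : ℂ) • u ∈ V) : u ∈ V ∧ v ∈ V := by
  -- This is the determinant (a + p)(a + q) - pq of the system.
  have hdet : ((a * (a + p + q) : ℕ) : ℂ) ≠ 0 :=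
    Nat.cast_ne_zero.2 (Nat.mul_ne_zero (by omega) (by omega))
  constructor
  · refine mem_of_smul_mem hdet ?_
    have h := V.sub_mem (V.smul_mem ((a + q : ℕ) : ℂ) h₁) (V.smul_mem (p : ℂ) h₂)
    convert h using 1
    push_cast
    module
  · refine mem_of_smul_mem hdet ?_
    have h := V.sub_mem (V.smul_mem ((a + p : ℕ) : ℂ) h₂) (V.smul_mem (q : ℂ) h₁)
    convert h using 1
    push_cast
    module

/-- Lowering creates one term containing `xx 0 * yy 0`. Rewriting it by `mono_relation` leaves only
monomials free of `yy 0`. -/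
theorem lower_one_mem (hV : OffDiagStable V) {c i j k m n : ℕ} (h : mono c ⟨i + 1, j, k, 0, m + 1, n⟩ ∈ V) :
    ((i + 1 + (m + 1) : ℕ) : ℂ) • mono c ⟨i, j + 1, k, 0, m + 1, n⟩
      + ((m + 1 : ℕ) : ℂ) • mono c ⟨i, j, k + 1, 0, m, n + 1⟩ ∈ V := by
  have h₁ := hV 1 0 (by decide) _ h
  rw [infAction_one_zero_mono] at h₁
  have hr := mono_relation c i j k 0 m n
  simp only [Nat.add_sub_cancel] at h₁
  convert h₁ using 1
  rw [add_assoc] at hr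
  rw [eq_neg_of_add_eq_zero_left hr]
  push_cast
  module

theorem lower_two_mem (hV : OffDiagStable V) {c i j k m n : ℕ} (h : mono c ⟨i + 1, j, k, 0, m, n + 1⟩ ∈ V) :
    ((i + 1 + (n + 1) : ℕ) : ℂ) • mono c ⟨i, j, k + 1, 0, m, n + 1⟩
      + ((n + 1 : ℕ) : ℂ) • mono c ⟨i, j + 1, k, 0, m + 1, n⟩ ∈ V := by
  have h₁ := hV 2 0 (by decide) _ h
  rw [infAction_two_zero_mono] at h₁
  have hr := mono_relation c i j k 0 m n
  simp only [Nat.add_sub_cancel] at h₁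
  convert h₁ using 1
  rw [add_assoc] at hr
  rw [eq_neg_of_add_eq_zero_left hr]
  push_cast
  module

/-- Induction on the degree in `xx 1`, `xx 2`. Neither lowering operator alone isolates a monomial,
but together they give an invertible system for a pair; where no partner exists, one operator
suffices. -/
theorem mono_mem_of_l_eq_zero (hV : OffDiagStable V) {c z b : ℕ} (h : mono c ⟨z, 0, 0, 0, 0, b⟩ ∈ V) (d : ℕ) :
    ∀ i j k m n, i + d = z → j + k = d → m + n = b → mono c ⟨i, j, k, 0, m, n⟩ ∈ V := by
  induction d with
  | zero =>
    intro i j k m n hi hjk hmn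
    obtain ⟨rfl, rfl⟩ : j = 0 ∧ k = 0 := by omega
    rw [add_zero] at hi
    subst hi hmn
    exact mono_mem_of_top hV m n h
  | succ d ih =>
    intro i j k m n hi hjk hmn
    have hpair : ∀ j' k' m' n', j' + k' = d → m' + n' + 1 = b →
        mono c ⟨i, j' + 1, k', 0, m' + 1, n'⟩ ∈ V ∧ mono c ⟨i, j', k' + 1, 0, m', n' + 1⟩ ∈ V := by
      intro j' k' m' n' h₁ h₂
      exact mem_of_two_by_two (Nat.succ_pos i)
        (lower_one_mem hV (ih (i + 1) j' k' (m' + 1) n' (by omega) h₁ (by omega)))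
        (lower_two_mem hV (ih (i + 1) j' k' m' (n' + 1) (by omega) h₁ (by omega)))
    have hi0 : ((i + 1 : ℕ) : ℂ) ≠ 0 := Nat.cast_ne_zero.2 (Nat.succ_ne_zero i)
    rcases j with _ | j
    · obtain rfl : k = d + 1 := by omega
      rcases n with _ | n
      · have h₁ := hV 2 0 (by decide) _ (ih (i + 1) 0 d m 0 (by omega) (by omega) hmn)
        rw [infAction_two_zero_mono, Nat.cast_zero, zero_smul, sub_zero] at h₁
        exact mem_of_smul_mem hi0 h₁
      · exact (hpair 0 d m n (by omega) hmn).2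
    · rcases m with _ | m
      · have h₁ := hV 1 0 (by decide) _ (ih (i + 1) j k 0 n (by omega) (by omega) hmn)
        rw [infAction_one_zero_mono, Nat.cast_zero, zero_smul, sub_zero] at h₁
        exact mem_of_smul_mem hi0 h₁
      · exact (hpair j k m n (by omega) (by omega)).1

/-- Without `xx 0`, the operator only turns a factor `yy 1` into `-yy 0`, so `l` can be raised step
by step. -/
theorem mono_mem_of_i_eq_zero (hV : OffDiagStable V) {c z b : ℕ} (h : mono c ⟨z, 0, 0, 0, 0, b⟩ ∈ V) (l : ℕ) :
    ∀ j k m n, j + k = z → l + m + n = b → mono c ⟨0, j, k, l, m, n⟩ ∈ V := by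
  induction l with
  | zero =>
    intro j k m n hjk hmn
    exact mono_mem_of_l_eq_zero hV h z 0 j k m n (by omega) hjk (by omega)
  | succ l ih =>
    intro j k m n hjk hmn
    have h₁ := hV 1 0 (by decide) _ (ih j k (m + 1) n hjk (by omega))
    rw [infAction_one_zero_mono, Nat.cast_zero, zero_smul, zero_sub, V.neg_mem_iff] at h₁
    exact mem_of_smul_mem (Nat.cast_ne_zero.2 (Nat.succ_ne_zero m)) h₁

/-- A subspace stable under the lowering operators that contains the highest weight vector
contains all monomials of the same bidegree. -/
theorem mono_mem_of_hwVector_mem (hV : OffDiagStable V) {c z b : ℕ} (h : mono c ⟨z, 0, 0, 0, 0, b⟩ ∈ V) (i : ℕ) :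
    ∀ j k l m n, i + j + k = z → l + m + n = b → mono c ⟨i, j, k, l, m, n⟩ ∈ V := by
  induction i with
  | zero =>
    intro j k l m n hjk hmn
    exact mono_mem_of_i_eq_zero hV h l j k m n (by omega) hmn
  | succ i ih =>
    intro j k l m n hjk hmn
    rcases l with _ | l
    · exact mono_mem_of_l_eq_zero hV h (j + k) (i + 1) j k m n (by omega) rfl (by omega)
    -- Both `xx 0` and `yy 0` occur, so the relation trades them for monomials with smaller `i`.
    · have hr := mono_relation c i j k l m n
      rw [add_assoc] at hr
      rw [eq_neg_of_add_eq_zero_left hr]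
      exact V.neg_mem (V.add_mem (ih (j + 1) k l (m + 1) n (by omega) (by omega))
        (ih j (k + 1) l m (n + 1) (by omega) (by omega)))

end Generation

/-! ### The span of the monomials of a given bidegree -/

/-- The span of the monomials of bidegree `(z, b)`. -/
def monoSpan (c z b : ℕ) : Submodule ℂ (MatPoly 3) :=
  Submodule.span ℂ (mono c '' bidegExps z b)

theorem mono_mem_monoSpan (c : ℕ) {z b i j k l m n : ℕ} (h₁ : i + j + k = z)
    (h₂ : l + m + n = b) : mono c ⟨i, j, k, l, m, n⟩ ∈ monoSpan c z b :=
  Submodule.subset_span ⟨_, ⟨h₁, h₂⟩, rfl⟩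

theorem xx_mul_mem {c z b : ℕ} {f : MatPoly 3} (hf : f ∈ monoSpan c z b) (p : Fin 3) :
    f * xx p ∈ monoSpan c (z + 1) b := by
  induction hf using Submodule.span_induction with
  | zero => rw [zero_mul]; exact Submodule.zero_mem _
  | add f g _ _ hf hg => rw [add_mul]; exact Submodule.add_mem _ hf hg
  | smul a f _ hf => rw [smul_mul_assoc]; exact Submodule.smul_mem _ a hf
  | mem f hf =>
    obtain ⟨⟨i, j, k, l, m, n⟩, ⟨h₁, h₂⟩, rfl⟩ := hf
    simp only at h₁ h₂
    fin_cases p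
    · convert mono_mem_monoSpan c (i := i + 1) (j := j) (k := k) (z := z + 1) (by omega) h₂ using 1
      simp only [mono, Fin.zero_eta]; ring
    · convert mono_mem_monoSpan c (i := i) (j := j + 1) (k := k) (z := z + 1) (by omega) h₂ using 1
      simp only [mono, Fin.mk_one]; ring
    · convert mono_mem_monoSpan c (i := i) (j := j) (k := k + 1) (z := z + 1) (by omega) h₂ using 1
      simp only [mono, Fin.reduceFinMk]; ring

theorem yy_mul_mem {c z b : ℕ} {f : MatPoly 3} (hf : f ∈ monoSpan c z b) (p : Fin 3) :
    f * yy p ∈ monoSpan c z (b + 1) := by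
  induction hf using Submodule.span_induction with
  | zero => rw [zero_mul]; exact Submodule.zero_mem _
  | add f g _ _ hf hg => rw [add_mul]; exact Submodule.add_mem _ hf hg
  | smul a f _ hf => rw [smul_mul_assoc]; exact Submodule.smul_mem _ a hf
  | mem f hf =>
    obtain ⟨⟨i, j, k, l, m, n⟩, ⟨h₁, h₂⟩, rfl⟩ := hf
    simp only at h₁ h₂
    fin_cases p
    · convert mono_mem_monoSpan c (l := l + 1) (m := m) (n := n) (b := b + 1) h₁ (by omega) using 1
      simp only [mono, Fin.zero_eta]; ring
    · convert mono_mem_monoSpan c (l := l) (m := m + 1) (n := n) (b := b + 1) h₁ (by omega) using 1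
      simp only [mono, Fin.mk_one]; ring
    · convert mono_mem_monoSpan c (l := l) (m := m) (n := n + 1) (b := b + 1) h₁ (by omega) using 1
      simp only [mono, Fin.reduceFinMk]; ring

theorem linear_pow_mul_mem (c z b : ℕ) {X Y : MatPoly 3}
    (hX : X ∈ Submodule.span ℂ (Set.range xx)) (hY : Y ∈ Submodule.span ℂ (Set.range yy)) :
    dd ^ c * X ^ z * Y ^ b ∈ monoSpan c z b := by
  have hX' : ∀ z b f, f ∈ monoSpan c z b → f * X ∈ monoSpan c (z + 1) b := by
    intro z b f hf
    induction hX using Submodule.span_induction with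
    | zero => rw [mul_zero]; exact Submodule.zero_mem _
    | add g g' _ _ hg hg' => rw [mul_add]; exact Submodule.add_mem _ hg hg'
    | smul a g _ hg => rw [mul_smul_comm]; exact Submodule.smul_mem _ a hg
    | mem g hg => obtain ⟨p, rfl⟩ := hg; exact xx_mul_mem hf p
  have hY' : ∀ z b f, f ∈ monoSpan c z b → f * Y ∈ monoSpan c z (b + 1) := by
    intro z b f hf
    induction hY using Submodule.span_induction with
    | zero => rw [mul_zero]; exact Submodule.zero_mem _
    | add g g' _ _ hg hg' => rw [mul_add]; exact Submodule.add_mem _ hg hg'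
    | smul a g _ hg => rw [mul_smul_comm]; exact Submodule.smul_mem _ a hg
    | mem g hg => obtain ⟨p, rfl⟩ := hg; exact yy_mul_mem hf p
  induction b with
  | zero =>
    rw [pow_zero, mul_one]
    induction z with
    | zero =>
      have h := mono_mem_monoSpan c (z := 0) (b := 0) (i := 0) (j := 0) (k := 0) (l := 0) (m := 0)
        (n := 0) rfl rfl
      simpa [mono] using h
    | succ z ih => rw [pow_succ, ← mul_assoc]; exact hX' z 0 _ ih
  | succ b ih => rw [pow_succ, ← mul_assoc]; exact hY' z b _ ih

/-- Straightening: replacing a factor `xx 2 * yy 2` by the other two products lowers `k`. -/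
theorem mono_mem_span_std (c z b : ℕ) (k : ℕ) : ∀ i j l m n, i + j + k = z → l + m + n = b →
    mono c ⟨i, j, k, l, m, n⟩ ∈ Submodule.span ℂ (mono c '' stdExps z b) := by
  induction k with
  | zero =>
    intro i j l m n h₁ h₂
    exact Submodule.subset_span ⟨_, ⟨⟨h₁, h₂⟩, Or.inl rfl⟩, rfl⟩
  | succ k ih =>
    intro i j l m n h₁ h₂
    rcases n with _ | n
    · exact Submodule.subset_span ⟨_, ⟨⟨h₁, h₂⟩, Or.inr rfl⟩, rfl⟩
    · rw [eq_neg_of_add_eq_zero_right (mono_relation c i j k l m n)]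
      exact Submodule.neg_mem _ (Submodule.add_mem _
        (ih (i + 1) j (l + 1) m n (by omega) (by omega))
        (ih i (j + 1) l (m + 1) n (by omega) (by omega)))

theorem monoSpan_eq_span_std (c z b : ℕ) :
    monoSpan c z b = Submodule.span ℂ (mono c '' stdExps z b) := by
  apply le_antisymm
  · rw [monoSpan, Submodule.span_le]
    rintro _ ⟨⟨i, j, k, l, m, n⟩, ⟨h₁, h₂⟩, rfl⟩
    exact mono_mem_span_std c z b k i j l m n h₁ h₂
  · refine Submodule.span_mono (Set.image_mono fun s hs => ?_)
    exact hs.1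

end

noncomputable section

/-! ### Linear independence of the standard monomials -/

/-- Polynomials with distinct degrees for a monomial order are linearly independent. -/
theorem linearIndependent_of_degree_injective {σ ι K : Type*} [Field K] (m : MonomialOrder σ)
    (f : ι → MvPolynomial σ K) (h0 : ∀ i, f i ≠ 0)
    (hinj : Function.Injective fun i => m.degree (f i)) : LinearIndependent K f := by
  classical
  rw [linearIndependent_iff']
  intro s a hsum
  by_contra! hne
  obtain ⟨i₀, hi₀, hai₀⟩ := hne
  obtain ⟨i, hi, hmax⟩ := Finset.exists_max_image (s.filter fun i => a i ≠ 0)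
    (fun i => m.toSyn (m.degree (f i))) ⟨i₀, Finset.mem_filter.2 ⟨hi₀, hai₀⟩⟩
  rw [Finset.mem_filter] at hi
  have h := congrArg (coeff (m.degree (f i))) hsum
  rw [coeff_sum, Finset.sum_eq_single i] at h
  · rw [coeff_smul, coeff_zero, smul_eq_mul, mul_eq_zero] at h
    exact h.elim hi.2 (m.leadingCoeff_ne_zero_iff.2 (h0 i))
  · intro j hj hji
    rw [coeff_smul]
    by_cases haj : a j = 0
    · rw [haj, zero_smul]
    · rw [m.coeff_eq_zero_of_lt, smul_zero]
      refine lt_of_le_of_ne (hmax j (Finset.mem_filter.2 ⟨hj, haj⟩)) fun heq => hji ?_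
      exact hinj (m.toSyn.injective heq)
  · exact fun h' => absurd hi.1 h'

/-- Restriction of polynomial functions to the matrices with rows `(p, q, 1)`, `(1, r, 0)`,
`(0, 1, 0)`; the variables `p, r, q` are numbered in this order. -/
def specialize : MatPoly 3 →ₐ[ℂ] MvPolynomial (Fin 3) ℂ :=
  aeval fun x => (!![X 0, X 2, 1; 1, X 1, 0; 0, 1, 0] :
    Matrix (Fin 3) (Fin 3) (MvPolynomial (Fin 3) ℂ)) x.1 x.2

theorem specialize_mono (c : ℕ) (s : Exps) :
    specialize (mono c s) = X 0 ^ s.i * X 2 ^ s.j * ((-X 1) ^ s.l * (X 0 * X 1 - X 2) ^ s.n) := by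
  have hd : specialize dd = 1 := by
    simp [dd_eq, yy, specialize]
  simp only [mono, map_mul, map_pow, hd]
  simp [xx, yy, specialize]

/-- In lexicographic order the leading term of `X 0 * X 1 - X 2`, the image of `yy 2`, is `X 0 * X
1`; the images of `xx 2`, `yy 1` and `dd` are 1. -/
theorem degree_specialize_mono (c : ℕ) (s : Exps) :
    MonomialOrder.lex.degree (specialize (mono c s))
      = (s.i + s.n) • Finsupp.single 0 1 + (s.l + s.n) • Finsupp.single 1 1
        + s.j • Finsupp.single 2 1 := by
  have hlt : MonomialOrder.lex.toSyn (MonomialOrder.lex.degree (X 2 : MvPolynomial (Fin 3) ℂ))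
      < MonomialOrder.lex.toSyn
        (MonomialOrder.lex.degree (X 0 * X 1 : MvPolynomial (Fin 3) ℂ)) := by
    rw [MonomialOrder.degree_mul (X_ne_zero _) (X_ne_zero _), MonomialOrder.degree_X,
      MonomialOrder.degree_X, MonomialOrder.degree_X, MonomialOrder.lex_lt_iff,
      Finsupp.Lex.lt_iff]
    exact ⟨0, by simp, by simp⟩
  have hsub : MonomialOrder.lex.degree (X 0 * X 1 - X 2 : MvPolynomial (Fin 3) ℂ)
      = Finsupp.single 0 1 + Finsupp.single 1 1 := by
    rw [MonomialOrder.degree_sub_of_lt hlt, MonomialOrder.degree_mul (X_ne_zero _) (X_ne_zero _),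
      MonomialOrder.degree_X, MonomialOrder.degree_X]
  have hne : (X 0 * X 1 - X 2 : MvPolynomial (Fin 3) ℂ) ≠ 0 := by
    intro h
    rw [h, MonomialOrder.degree_zero] at hsub
    have := DFunLike.congr_fun hsub 0
    simp at this
  have hX : ∀ i, (X i : MvPolynomial (Fin 3) ℂ) ≠ 0 := X_ne_zero
  rw [specialize_mono, MonomialOrder.degree_mul (mul_ne_zero (pow_ne_zero _ (hX _))
      (pow_ne_zero _ (hX _))) (mul_ne_zero (pow_ne_zero _ (neg_ne_zero.2 (hX _)))
        (pow_ne_zero _ hne)),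
    MonomialOrder.degree_mul (pow_ne_zero _ (hX _)) (pow_ne_zero _ (hX _)),
    MonomialOrder.degree_mul (pow_ne_zero _ (neg_ne_zero.2 (hX _))) (pow_ne_zero _ hne),
    MonomialOrder.degree_pow, MonomialOrder.degree_pow, MonomialOrder.degree_pow,
    MonomialOrder.degree_pow, MonomialOrder.degree_neg, hsub, MonomialOrder.degree_X,
    MonomialOrder.degree_X, MonomialOrder.degree_X]
  module

theorem linearIndependent_mono (c z b : ℕ) :
    LinearIndependent ℂ fun s : stdExps z b => mono c s.1 := by
  refine LinearIndependent.of_comp specialize.toLinearMap ?_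
  refine linearIndependent_of_degree_injective MonomialOrder.lex _ (fun s => ?_) ?_
  · intro h
    have hX : ∀ i, (X i : MvPolynomial (Fin 3) ℂ) ≠ 0 := X_ne_zero
    have h' : specialize (mono c s.1) = 0 := h
    rw [specialize_mono] at h'
    have hne : (X 0 * X 1 - X 2 : MvPolynomial (Fin 3) ℂ) ≠ 0 := by
      intro h0
      have := congrArg (eval ![0, 0, 1]) h0
      simp at this
    exact mul_ne_zero (mul_ne_zero (pow_ne_zero _ (hX _)) (pow_ne_zero _ (hX _)))
      (mul_ne_zero (pow_ne_zero _ (neg_ne_zero.2 (hX _))) (pow_ne_zero _ hne)) h'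
  · rintro ⟨s, ⟨h₁, h₂⟩, h₃⟩ ⟨s', ⟨h₁', h₂'⟩, h₃'⟩ h
    change MonomialOrder.lex.degree (specialize (mono c s))
      = MonomialOrder.lex.degree (specialize (mono c s')) at h
    rw [degree_specialize_mono, degree_specialize_mono] at h
    have e₀ := DFunLike.congr_fun h 0
    have e₁ := DFunLike.congr_fun h 1
    have e₂ := DFunLike.congr_fun h 2
    simp at e₀ e₁ e₂
    -- With the bidegree fixed, `i + n` and `j` determine `n - k`. Since one of `k`, `n` is zero
    -- this determines both, and then all other exponents.
    have hs : s = s' :=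
      Exps.ext (by omega) (by omega) (by omega) (by omega) (by omega) (by omega)
    exact Subtype.ext hs

/-! ### The irreducible representation as a span of monomials -/

theorem rightMul_xx (A : Matrix (Fin 3) (Fin 3) ℂ) (p : Fin 3) :
    rightMul 3 A (xx p) = ∑ k, A k p • xx k := by
  simp only [xx, rightMul_X, mulEntry, smul_eq_C_mul]

theorem rightMul_yy_two (A : Matrix (Fin 3) (Fin 3) ℂ) :
    rightMul 3 A (yy 2) = (A 1 0 * A 2 1 - A 2 0 * A 1 1) • yy 0
      + (A 2 0 * A 0 1 - A 0 0 * A 2 1) • yy 1 + (A 0 0 * A 1 1 - A 1 0 * A 0 1) • yy 2 := by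
  simp only [yy, Matrix.cons_val, map_sub, map_mul, rightMul_X, mulEntry, smul_eq_C_mul,
    Fin.sum_univ_three]
  ring

theorem rightMul_dd (A : Matrix (Fin 3) (Fin 3) ℂ) : rightMul 3 A dd = A.det • dd := by
  have h : (rightMul 3 A).mapMatrix (Matrix.of fun i j => (X (i, j) : MatPoly 3))
      = (Matrix.of fun i j => (X (i, j) : MatPoly 3)) * C.mapMatrix A := by
    ext1 i j
    simp only [AlgHom.mapMatrix_apply, Matrix.map_apply, Matrix.of_apply, rightMul_X, mulEntry,
      Matrix.mul_apply, RingHom.mapMatrix_apply]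
    exact Finset.sum_congr rfl fun k _ => mul_comm _ _
  rw [dd, AlgHom.map_det, h, Matrix.det_mul, ← RingHom.map_det, smul_eq_C_mul, mul_comm]

theorem rightMul_hw (A : Matrix (Fin 3) (Fin 3) ℂ) (c z b : ℕ) :
    rightMul 3 A (mono c ⟨z, 0, 0, 0, 0, b⟩) ∈ monoSpan c z b := by
  have h : rightMul 3 A (mono c ⟨z, 0, 0, 0, 0, b⟩)
      = A.det ^ c • (dd ^ c * rightMul 3 A (xx 0) ^ z * rightMul 3 A (yy 2) ^ b) := by
    simp only [mono, map_mul, map_pow, rightMul_dd, smul_pow, pow_zero, mul_one, one_mul,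
      smul_mul_assoc, mul_assoc]
  rw [h]
  refine Submodule.smul_mem _ _ (linear_pow_mul_mem c z b ?_ ?_)
  · rw [rightMul_xx]
    exact Submodule.sum_mem _ fun k _ =>
      Submodule.smul_mem _ _ (Submodule.subset_span (Set.mem_range_self k))
  · rw [rightMul_yy_two]
    refine Submodule.add_mem _ (Submodule.add_mem _ ?_ ?_) ?_ <;>
      exact Submodule.smul_mem _ _ (Submodule.subset_span (Set.mem_range_self _))

/-- Homogeneity of the highest weight vector makes the unitary span stable under scalar multiples of
unitary matrices, as `infAction_single_mem` requires. -/
theorem rightMul_scalar_hw (a : ℂ) (c z b : ℕ) :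
    rightMul 3 (a • 1) (mono c ⟨z, 0, 0, 0, 0, b⟩)
      = ((a ^ 3) ^ c * a ^ z * (a ^ 2) ^ b) • mono c ⟨z, 0, 0, 0, 0, b⟩ := by
  have h₁ : rightMul 3 (a • 1) (xx 0) = a • xx 0 := by
    rw [rightMul_xx, Fin.sum_univ_three]
    simp
  have h₂ : rightMul 3 (a • 1) (yy 2) = a ^ 2 • yy 2 := by
    rw [rightMul_yy_two]
    simp [pow_two]
  have h₃ : rightMul 3 (a • 1) dd = a ^ 3 • dd := by
    rw [rightMul_dd]
    simp
  simp only [mono, map_mul, map_pow, h₁, h₂, h₃, smul_pow, pow_zero, mul_one, one_mul,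
    smul_mul_smul_comm, mul_assoc]

theorem leadingMinor_eq (k : ℕ) (hk : k ≤ 3) :
    leadingMinor 3 k = (Matrix.of fun i j : Fin k =>
      (X (Fin.castLE hk i, Fin.castLE hk j) : MatPoly 3)).det := by
  let e : Fin k ≃ {i : Fin 3 // (i : ℕ) < k} :=
    { toFun := fun i => ⟨Fin.castLE hk i, i.2⟩
      invFun := fun i => ⟨i.1, i.2⟩
      left_inv := fun i => rfl
      right_inv := fun i => rfl }
  rw [leadingMinor, ← Matrix.det_submatrix_equiv_self e]
  rfl

theorem leadingMinor_one : leadingMinor 3 1 = xx 0 := by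
  rw [leadingMinor_eq 1 (by norm_num), Matrix.det_fin_one]
  rfl

theorem leadingMinor_two : leadingMinor 3 2 = yy 2 := by
  rw [leadingMinor_eq 2 (by norm_num), Matrix.det_fin_two]
  rfl

theorem leadingMinor_three : leadingMinor 3 3 = dd := by
  rw [leadingMinor_eq 3 le_rfl]
  rfl

theorem hwVector_eq {μ : YoungDiagram} {c z b : ℕ} (hμ : μ.colLen 0 ≤ 3)
    (h₀ : μ.rowLen 0 = z + b + c) (h₁ : μ.rowLen 1 = b + c) (h₂ : μ.rowLen 2 = c) :
    hwVector 3 μ = mono c ⟨z, 0, 0, 0, 0, b⟩ := by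
  have hcol : ∀ i j, j < μ.rowLen i → i < μ.colLen j := fun i j h =>
    YoungDiagram.mem_iff_lt_colLen.1 (YoungDiagram.mem_iff_lt_rowLen.2 h)
  have hcol' : ∀ i j, i < μ.colLen j → j < μ.rowLen i := fun i j h =>
    YoungDiagram.mem_iff_lt_rowLen.1 (YoungDiagram.mem_iff_lt_colLen.2 h)
  have hle : ∀ j, μ.colLen j ≤ 3 := fun j => (μ.colLen_anti 0 j (Nat.zero_le j)).trans hμ
  -- The first `c` columns have length 3, the next `b` length 2, the last `z` length 1.
  rw [hwVector, h₀, show z + b + c = c + b + z by ring, Finset.prod_range_add,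
    Finset.prod_range_add]
  have e₃ : ∏ j ∈ Finset.range c, leadingMinor 3 (μ.colLen j) = dd ^ c := by
    rw [Finset.prod_congr rfl fun j hj => ?_, Finset.prod_const, Finset.card_range]
    have := hcol 2 j (by rw [h₂]; exact Finset.mem_range.1 hj)
    rw [show μ.colLen j = 3 by have := hle j; omega, leadingMinor_three]
  have e₂ : ∏ j ∈ Finset.range b, leadingMinor 3 (μ.colLen (c + j)) = yy 2 ^ b := by
    rw [Finset.prod_congr rfl fun j hj => ?_, Finset.prod_const, Finset.card_range]
    have hj := Finset.mem_range.1 hj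
    have h := hcol 1 (c + j) (by omega)
    have h' : ¬ 2 < μ.colLen (c + j) := fun h' => by
      have := hcol' 2 _ h'
      omega
    rw [show μ.colLen (c + j) = 2 by omega, leadingMinor_two]
  have e₁ : ∏ j ∈ Finset.range z, leadingMinor 3 (μ.colLen (c + b + j)) = xx 0 ^ z := by
    rw [Finset.prod_congr rfl fun j hj => ?_, Finset.prod_const, Finset.card_range]
    have hj := Finset.mem_range.1 hj
    have h := hcol 0 (c + b + j) (by omega)
    have h' : ¬ 1 < μ.colLen (c + b + j) := fun h' => by
      have := hcol' 1 _ h'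
      omega
    rw [show μ.colLen (c + b + j) = 1 by omega, leadingMinor_one]
  rw [e₁, e₂, e₃]
  simp only [mono, pow_zero]
  ring

/-- Substitution sends the highest weight vector to a product of powers of linear forms, inside the
span. Conversely, unitary stability passes to matrix units, and lowering operators reach every
monomial. -/
theorem irrepSub_eq_monoSpan {μ : YoungDiagram} {c z b : ℕ} (hμ : μ.colLen 0 ≤ 3)
    (h₀ : μ.rowLen 0 = z + b + c) (h₁ : μ.rowLen 1 = b + c) (h₂ : μ.rowLen 2 = c) :
    (irrepSub 3 μ).toSubmodule = monoSpan c z b := by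
  have hV : (irrepSub 3 μ).toSubmodule = Submodule.span ℂ (Set.range fun u : U 3 =>
      rightMul 3 (u : Matrix (Fin 3) (Fin 3) ℂ) (mono c ⟨z, 0, 0, 0, 0, b⟩)) := by
    rw [← hwVector_eq hμ h₀ h₁ h₂]
    rfl
  rw [hV]
  apply le_antisymm
  · rw [Submodule.span_le]
    rintro _ ⟨u, rfl⟩
    exact rightMul_hw _ c z b
  · set V := Submodule.span ℂ (Set.range fun u : U 3 =>
      rightMul 3 (u : Matrix (Fin 3) (Fin 3) ℂ) (mono c ⟨z, 0, 0, 0, 0, b⟩)) with hVdef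
    have hstable : ∀ (a : ℂ) (u : U 3), ∀ f ∈ V,
        rightMul 3 (a • (u : Matrix (Fin 3) (Fin 3) ℂ)) f ∈ V := by
      intro a u f hf
      induction hf using Submodule.span_induction with
      | zero => rw [map_zero]; exact V.zero_mem
      | add f g _ _ hf hg => rw [map_add]; exact V.add_mem hf hg
      | smul d f _ hf => rw [map_smul]; exact V.smul_mem d hf
      | mem f hf =>
        obtain ⟨w, rfl⟩ := hf
        have h : rightMul 3 (a • (u : Matrix (Fin 3) (Fin 3) ℂ))
            (rightMul 3 (w : Matrix (Fin 3) (Fin 3) ℂ) (mono c ⟨z, 0, 0, 0, 0, b⟩))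
            = rightMul 3 ((u * w : U 3) : Matrix (Fin 3) (Fin 3) ℂ)
              (rightMul 3 (a • 1) (mono c ⟨z, 0, 0, 0, 0, b⟩)) := by
          rw [← AlgHom.comp_apply, ← rightMul_mul, ← AlgHom.comp_apply, ← rightMul_mul,
            Submonoid.coe_mul, Matrix.smul_mul, Matrix.mul_smul, mul_one]
        simp only
        rw [h, rightMul_scalar_hw, map_smul]
        exact V.smul_mem _ (Submodule.subset_span ⟨u * w, rfl⟩)
    have hinf : ∀ p q : Fin 3, p ≠ q → ∀ f ∈ V, infAction (Matrix.single p q (1 : ℂ)) f ∈ V :=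
      fun p q hpq f hf => infAction_single_mem V hstable hpq hf
    have htop : mono c ⟨z, 0, 0, 0, 0, b⟩ ∈ V := by
      refine Submodule.subset_span ⟨1, ?_⟩
      simp only [Submonoid.coe_one, rightMul_one, AlgHom.id_apply]
    rw [monoSpan, Submodule.span_le]
    rintro _ ⟨⟨i, j, k, l, m, n⟩, ⟨h₁, h₂⟩, rfl⟩
    exact mono_mem_of_hwVector_mem hinf htop i j k l m n h₁ h₂

end

noncomputable section

/-! ### The action of the generators of the subgroups on the monomials -/

theorem rightMul_diagonal_mono (d : Fin 3 → ℂ) (c : ℕ) (s : Exps) :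
    rightMul 3 (Matrix.diagonal d) (mono c s)
      = ((d 0 * d 1 * d 2) ^ c * (d 0 ^ s.i * d 1 ^ s.j * d 2 ^ s.k * ((d 1 * d 2) ^ s.l
        * (d 0 * d 2) ^ s.m * (d 0 * d 1) ^ s.n))) • mono c s := by
  have hX : ∀ i j, rightMul 3 (Matrix.diagonal d) (X (i, j)) = C (d j) * X (i, j) := by
    intro i j
    rw [rightMul_X, mulEntry, Finset.sum_eq_single j]
    · simp
    · intro k _ hk
      simp [Matrix.diagonal_apply_ne _ hk]
    · simp
  have hx : ∀ p, rightMul 3 (Matrix.diagonal d) (xx p) = d p • xx p := fun p => by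
    rw [xx, hX, smul_eq_C_mul]
  have h₀ : rightMul 3 (Matrix.diagonal d) (yy 0) = (d 1 * d 2) • yy 0 := by
    simp only [yy, Matrix.cons_val, map_sub, map_mul, hX, smul_eq_C_mul]; ring
  have h₁ : rightMul 3 (Matrix.diagonal d) (yy 1) = (d 0 * d 2) • yy 1 := by
    simp only [yy, Matrix.cons_val, map_sub, map_mul, hX, smul_eq_C_mul]; ring
  have h₂ : rightMul 3 (Matrix.diagonal d) (yy 2) = (d 0 * d 1) • yy 2 := by
    simp only [yy, Matrix.cons_val, map_sub, map_mul, hX, smul_eq_C_mul]; ring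
  have hd : rightMul 3 (Matrix.diagonal d) dd = (d 0 * d 1 * d 2) • dd := by
    rw [rightMul_dd, Matrix.det_diagonal, Fin.prod_univ_three]
  simp only [mono, map_mul, map_pow, hx, h₀, h₁, h₂, hd, smul_pow, smul_mul_smul_comm]

theorem polyRep_torusElt_mono (t : Circle) (c : ℕ) (s : Exps) :
    polyRep 3 (torusElt t) (mono c s)
      = ((t : ℂ) ^ (s.i + s.m) * ((t : ℂ)⁻¹) ^ (s.j + s.l)) • mono c s := by
  have h : ((torusElt t : U 3) : Matrix (Fin 3) (Fin 3) ℂ)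
      = Matrix.diagonal ![(t : ℂ), (t : ℂ)⁻¹, 1] := by
    ext i j
    fin_cases i <;> fin_cases j <;> simp [torusElt]
  have ht : (t : ℂ) ≠ 0 := t.coe_ne_zero
  change rightMul 3 ((torusElt t : U 3) : Matrix (Fin 3) (Fin 3) ℂ) (mono c s) = _
  rw [h, rightMul_diagonal_mono]
  congr 1
  simp only [Matrix.cons_val, mul_inv_cancel₀ ht, mul_one, one_pow, one_mul]
  ring

theorem polyRep_zeta34_mono (c : ℕ) (s : Exps) :
    polyRep 3 zeta34 (mono c s)
      = Complex.I ^ (s.i + s.j + s.l + s.m + 2 * s.n + 2 * c) • mono c s := by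
  have h : ((zeta34 : U 3) : Matrix (Fin 3) (Fin 3) ℂ)
      = Matrix.diagonal ![Complex.I, Complex.I, 1] := by
    ext i j
    fin_cases i <;> fin_cases j <;> simp [zeta34]
  change rightMul 3 ((zeta34 : U 3) : Matrix (Fin 3) (Fin 3) ℂ) (mono c s) = _
  rw [h, rightMul_diagonal_mono]
  congr 1
  simp only [Matrix.cons_val, mul_one, one_pow, ← pow_two, ← pow_mul, ← pow_add]
  congr 1
  ring

theorem polyRep_J3_mono (c : ℕ) (s : Exps) :
    polyRep 3 J3 (mono c s) = ((-1 : ℂ) ^ (s.i + s.l)) • mono c s.swap := by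
  change rightMul 3 ((J3 : U 3) : Matrix (Fin 3) (Fin 3) ℂ) (mono c s) = _
  have hJ : ((J3 : U 3) : Matrix (Fin 3) (Fin 3) ℂ) = !![0, 1, 0; -1, 0, 0; 0, 0, 1] := rfl
  rw [hJ]
  set A : Matrix (Fin 3) (Fin 3) ℂ := !![0, 1, 0; -1, 0, 0; 0, 0, 1] with hA
  have hX₀ : ∀ i, rightMul 3 A (X (i, 0)) = -X (i, 1) := fun i => by
    rw [rightMul_X, mulEntry, Fin.sum_univ_three]; simp [hA]
  have hX₁ : ∀ i, rightMul 3 A (X (i, 1)) = X (i, 0) := fun i => by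
    rw [rightMul_X, mulEntry, Fin.sum_univ_three]; simp [hA]
  have hX₂ : ∀ i, rightMul 3 A (X (i, 2)) = X (i, 2) := fun i => by
    rw [rightMul_X, mulEntry, Fin.sum_univ_three]; simp [hA]
  have h₀ : rightMul 3 A (yy 0) = -yy 1 := by
    simp only [yy, Matrix.cons_val, map_sub, map_mul, hX₁, hX₂]; ring
  have h₁ : rightMul 3 A (yy 1) = yy 0 := by
    simp only [yy, Matrix.cons_val, map_sub, map_mul, hX₀, hX₂]; ring
  have h₂ : rightMul 3 A (yy 2) = yy 2 := by
    simp only [yy, Matrix.cons_val, map_sub, map_mul, hX₀, hX₁]; ring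
  have hd : rightMul 3 A dd = dd := by
    rw [rightMul_dd]
    simp [hA, Matrix.det_fin_three]
  have h : (((-1 : ℂ) ^ (s.i + s.l)) • mono c s.swap : MatPoly 3)
      = (-1) ^ (s.i + s.l) * mono c s.swap := by
    rw [smul_eq_C_mul, C_pow, C_neg, C_1]
  rw [h]
  simp only [mono, map_mul, map_pow, xx, hX₀, hX₁, hX₂, h₀, h₁, h₂, hd, Exps.swap,
    neg_pow (X (0, 1) : MatPoly 3), neg_pow (yy 1)]
  ring

/-! ### The multiplicities -/

theorem exists_circle_pow_ne {a b : ℕ} (h : a ≠ b) :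
    ∃ t : Circle, (t : ℂ) ^ a * ((t : ℂ)⁻¹) ^ b ≠ 1 := by
  wlog hlt : b < a generalizing a b
  · obtain ⟨t, ht⟩ := this h.symm (by omega)
    refine ⟨t⁻¹, ?_⟩
    rwa [Circle.coe_inv, inv_inv, mul_comm]
  obtain ⟨d, rfl⟩ := Nat.exists_eq_add_of_lt hlt
  -- The power `d + 1 = a - b` of this point is -1.
  refine ⟨Circle.exp (Real.pi / (d + 1)), ?_⟩
  set t := Circle.exp (Real.pi / (d + 1)) with ht
  have h0 : (t : ℂ) ≠ 0 := t.coe_ne_zero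
  have hd : (t : ℂ) ^ (d + 1) = -1 := by
    rw [ht, Circle.coe_exp, ← Complex.exp_nat_mul, ← Complex.exp_pi_mul_I]
    congr 1
    have : ((d : ℂ) + 1) ≠ 0 := by exact_mod_cast Nat.succ_ne_zero d
    push_cast
    field_simp
  rw [show b + d + 1 = d + 1 + b by ring, pow_add, hd, mul_assoc, ← mul_pow, mul_inv_cancel₀ h0,
    one_pow, mul_one]
  norm_num

theorem I_pow_eq_one_iff (n : ℕ) : Complex.I ^ n = 1 ↔ 4 ∣ n := by
  constructor
  · intro h
    rw [Complex.I_pow_eq_pow_mod] at h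
    have hlt : n % 4 < 4 := Nat.mod_lt _ (by norm_num)
    rw [Nat.dvd_iff_mod_eq_zero]
    interval_cases n % 4
    · rfl
    · exact absurd (congrArg Complex.re h) (by simp)
    · exact absurd (congrArg Complex.re h) (by norm_num)
    · exact absurd (congrArg Complex.re h) (by simp [pow_succ])
  · rintro ⟨k, rfl⟩
    rw [pow_mul, Complex.I_pow_four, one_pow]

theorem mem_invariants_closure_iff {G W : Type*} [Group G] [AddCommGroup W] [Module ℂ W]
    (ρ : Representation ℂ G W) (S : Set G) (v : W) :
    v ∈ Representation.invariants (ρ.comp (Subgroup.closure S).subtype) ↔ ∀ g ∈ S, ρ g v = v := by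
  rw [Representation.mem_invariants]
  constructor
  · intro h g hg
    exact h ⟨g, Subgroup.subset_closure hg⟩
  · rintro h ⟨g, hg⟩
    change ρ g v = v
    induction hg using Subgroup.closure_induction with
    | mem g hg => exact h g hg
    | one => simp
    | mul g g' _ _ hg hg' => rw [map_mul, Module.End.mul_apply, hg', hg]
    | inv g _ hg =>
      conv_lhs => rw [← hg]
      rw [← Module.End.mul_apply, ← map_mul, inv_mul_cancel, map_one, Module.End.one_apply]

variable {μ : YoungDiagram} {c z b : ℕ}

/-- The basis of standard monomials of the irreducible representation. -/
theorem exists_basis_irrep (hμ : μ.colLen 0 ≤ 3) (h₀ : μ.rowLen 0 = z + b + c)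
    (h₁ : μ.rowLen 1 = b + c) (h₂ : μ.rowLen 2 = c) :
    ∃ B : Module.Basis (stdExps z b) ℂ (irrepSub 3 μ).toSubmodule,
      ∀ s, (B s : MatPoly 3) = mono c s.1 := by
  have hV := (irrepSub_eq_monoSpan hμ h₀ h₁ h₂).trans (monoSpan_eq_span_std c z b)
  have hmem : ∀ s : stdExps z b, mono c s.1 ∈ (irrepSub 3 μ).toSubmodule := fun s => by
    rw [hV]
    exact Submodule.subset_span ⟨s.1, s.2, rfl⟩
  let v : stdExps z b → (irrepSub 3 μ).toSubmodule := fun s => ⟨mono c s.1, hmem s⟩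
  have hli : LinearIndependent ℂ v :=
    LinearIndependent.of_comp (irrepSub 3 μ).toSubmodule.subtype (linearIndependent_mono c z b)
  have hsp : ⊤ ≤ Submodule.span ℂ (Set.range v) := by
    rintro ⟨f, hf⟩ -
    have hr : Set.range ((irrepSub 3 μ).toSubmodule.subtype ∘ v) = mono c '' stdExps z b := by
      ext f
      constructor
      · rintro ⟨s, rfl⟩
        exact ⟨s.1, s.2, rfl⟩
      · rintro ⟨s, hs, rfl⟩
        exact ⟨⟨s, hs⟩, rfl⟩
    have hf' : f ∈ (Submodule.span ℂ (Set.range v)).map (irrepSub 3 μ).toSubmodule.subtype := by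
      rw [Submodule.map_span, ← Set.range_comp, hr, ← hV]
      exact hf
    obtain ⟨x, hx, hxf⟩ := hf'
    rwa [show x = ⟨f, hf⟩ from Subtype.ext hxf] at hx
  exact ⟨Module.Basis.mk hli hsp, fun s => by rw [Module.Basis.mk_apply]⟩

/-- Exchange of the indices `0` and `1` on standard exponents. -/
def stdSwap (s : stdExps z b) : stdExps z b := ⟨s.1.swap, swap_mem_stdExps s.2⟩

/-- Invariance under the diagonal generators, in coordinates. -/
theorem diag_invariant_iff
    (B : Module.Basis (stdExps z b) ℂ (irrepSub 3 μ).toSubmodule)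
    (hB : ∀ s, (B s : MatPoly 3) = mono c s.1) (v : (irrepSub 3 μ).toSubmodule) :
    ((∀ t, irrep 3 μ (torusElt t) v = v) ∧ irrep 3 μ zeta34 v = v)
      ↔ ∀ s, ¬ diagFixed c s.1 → B.repr v s = 0 := by
  have ht : ∀ t, irrep 3 μ (torusElt t) v = v ↔ ∀ s, B.repr v s
      = ((t : ℂ) ^ (s.1.i + s.1.m) * ((t : ℂ)⁻¹) ^ (s.1.j + s.1.l)) * B.repr v s := fun t =>
    map_eq_self_iff_of_signed_perm B _ id _ (fun _ => rfl) (fun s => Subtype.ext (by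
      change polyRep 3 (torusElt t) (B s : MatPoly 3) = _ • (B s : MatPoly 3)
      rw [hB, polyRep_torusElt_mono])) v
  have hz : irrep 3 μ zeta34 v = v ↔ ∀ s, B.repr v s
      = Complex.I ^ (s.1.i + s.1.j + s.1.l + s.1.m + 2 * s.1.n + 2 * c) * B.repr v s :=
    map_eq_self_iff_of_signed_perm B _ id _ (fun _ => rfl) (fun s => Subtype.ext (by
      change polyRep 3 zeta34 (B s : MatPoly 3) = _ • (B s : MatPoly 3)
      rw [hB, polyRep_zeta34_mono])) v
  have hone : ∀ a x : ℂ, x = a * x → a ≠ 1 → x = 0 := fun a x h ha => by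
    have : (a - 1) * x = 0 := by rw [sub_mul, one_mul, ← h, sub_self]
    exact (mul_eq_zero.1 this).resolve_left (sub_ne_zero.2 ha)
  constructor
  · rintro ⟨h₁, h₂⟩ s hs
    by_cases hs' : s.1.i + s.1.m = s.1.j + s.1.l
    · refine hone _ _ (hz.1 h₂ s) fun h => hs ⟨hs', (I_pow_eq_one_iff _).1 h⟩
    · obtain ⟨t, htne⟩ := exists_circle_pow_ne hs'
      exact hone _ _ ((ht t).1 (h₁ t) s) htne
  · intro h
    constructor
    · intro t
      rw [ht]
      intro s
      by_cases hs : diagFixed c s.1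
      · rw [hs.1, ← mul_pow, mul_inv_cancel₀ t.coe_ne_zero, one_pow, one_mul]
      · rw [h s hs, mul_zero]
    · rw [hz]
      intro s
      by_cases hs : diagFixed c s.1
      · rw [(I_pow_eq_one_iff _).2 hs.2, one_mul]
      · rw [h s hs, mul_zero]

theorem trivMult_H34' (hμ : μ.colLen 0 ≤ 3) (h₀ : μ.rowLen 0 = z + b + c)
    (h₁ : μ.rowLen 1 = b + c) (h₂ : μ.rowLen 2 = c) :
    trivMult 3 μ H34' = (Phi24 (z + b + c) (b + c) c).card := by
  obtain ⟨B, hB⟩ := exists_basis_irrep hμ h₀ h₁ h₂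
  rw [← card_diagFixed, trivMult]
  refine finrank_eq_card_orbitRep B _ (fun s => diagFixed c s.1) (fun s => diagFixed c s.1) id
    (fun _ => 1) (fun _ => rfl) (fun _ h => h) (fun _ _ => one_mul 1) (fun v => ?_)
    (fun _ h => h) (fun _ _ _ => ⟨rfl, rfl⟩) (fun s hs hs' => absurd hs hs')
  rw [H34', mem_invariants_closure_iff, ← diag_invariant_iff B hB]
  constructor
  · intro h
    exact ⟨⟨fun t => h _ (Or.inl ⟨t, rfl⟩), h _ (Or.inr rfl)⟩, fun s _ => (one_mul _).symm⟩
  · rintro ⟨⟨ht, hz⟩, -⟩ g (⟨t, rfl⟩ | rfl)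
    · exact ht t
    · exact hz

theorem diagFixed_swap (s : Exps) (h : diagFixed c s) : diagFixed c s.swap := by
  obtain ⟨h₁, h₂⟩ := h
  refine ⟨h₁.symm, ?_⟩
  simp only [Exps.swap]
  convert h₂ using 1
  ring

/-- Torus invariance makes the signs of a monomial and its partner multiply to 1. A monomial fixed
by the swap has `i = j` and `l = m` and carries the sign `(-1) ^ (i + l)`, so it contributes exactly
when `orbitRep` holds. -/
theorem trivMult_H34 (hμ : μ.colLen 0 ≤ 3) (h₀ : μ.rowLen 0 = z + b + c)
    (h₁ : μ.rowLen 1 = b + c) (h₂ : μ.rowLen 2 = c) :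
    trivMult 3 μ H34 = (Phi44 (z + b + c) (b + c) c).card := by
  obtain ⟨B, hB⟩ := exists_basis_irrep hμ h₀ h₁ h₂
  rw [← card_diagFixed_orbitRep, trivMult]
  refine finrank_eq_card_orbitRep B _ (fun s => diagFixed c s.1)
    (fun s => diagFixed c s.1 ∧ orbitRep s.1) stdSwap
    (fun s => (-1) ^ (s.1.i + s.1.l)) (fun _ => rfl) (fun s h => diagFixed_swap s.1 h)
    (fun s h => ?_) (fun v => ?_) (fun _ h => h.1) (fun s hs hs' => ?_) (fun s hs hs' hs'' => ?_)
  · have h' := h.1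
    simp only [stdSwap, Exps.swap]
    rw [← pow_add]
    exact Even.neg_one_pow ⟨s.1.i + s.1.m, by omega⟩
  · rw [H34, mem_invariants_closure_iff]
    have hJ : irrep 3 μ J3 v = v ↔ ∀ s, B.repr v (stdSwap s)
        = (-1 : ℂ) ^ (s.1.i + s.1.l) * B.repr v s :=
      map_eq_self_iff_of_signed_perm B _ stdSwap _ (fun _ => rfl) (fun s => Subtype.ext (by
        change polyRep 3 J3 (B s : MatPoly 3) = _ • (B (stdSwap s) : MatPoly 3)
        rw [hB, hB, polyRep_J3_mono]
        rfl)) v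
    constructor
    · intro h
      exact ⟨(diag_invariant_iff B hB v).1 ⟨fun t => h _ (Or.inl ⟨t, rfl⟩), h _ (Or.inr (Or.inr rfl))⟩,
        fun s _ => hJ.1 (h _ (Or.inr (Or.inl rfl))) s⟩
    · rintro ⟨hd, hs⟩
      have hd' := (diag_invariant_iff B hB v).2 hd
      rintro g (⟨t, rfl⟩ | rfl | rfl)
      · exact hd'.1 t
      · refine hJ.2 fun s => ?_
        -- Off the fixed monomials both coordinates vanish, so the condition on J holds there too.
        by_cases hf : diagFixed c s.1
        · exact hs s hf
        · rw [hd s hf, hd (stdSwap s) fun h => hf (diagFixed_swap _ h), mul_zero]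
      · exact hd'.2
  · obtain ⟨hf, hr⟩ := hs
    obtain ⟨-, hr'⟩ := hs'
    have hf' := hf.1
    simp only [orbitRep, stdSwap, Exps.swap] at hr hr'
    have hij : s.1.i = s.1.j := by omega
    refine ⟨Subtype.ext (Exps.ext hij.symm hij rfl ?_ ?_ rfl), ?_⟩
    · change s.1.m = s.1.l
      omega
    · change s.1.l = s.1.m
      omega
    · exact Even.neg_one_pow (even_iff_two_dvd.2 (by omega))
  · have hf := hs.1
    have hr : ¬ orbitRep s.1 := fun h => hs' ⟨hs, h⟩
    have hr' : ¬ orbitRep (stdSwap s).1 := fun h => hs'' ⟨diagFixed_swap _ hs, h⟩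
    simp only [orbitRep, stdSwap, Exps.swap] at hr hr'
    have hij : s.1.i = s.1.j := by omega
    refine ⟨Subtype.ext (Exps.ext hij.symm hij rfl ?_ ?_ rfl), ?_⟩
    · change s.1.m = s.1.l
      omega
    · change s.1.l = s.1.m
      omega
    · rw [Odd.neg_one_pow (Nat.not_even_iff_odd.1 fun h => by
        have := even_iff_two_dvd.1 h
        omega)]
      norm_num

/-! ### Translation invariance of the two counts -/

/-- Shifting p and q by `2 * k` changes p + q by a multiple of 4 and leaves p - q alone; this
removes k from the formulas. -/
theorem card_Phi24_add_two_mul (a b c k : ℕ) :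
    (Phi24 (a + 2 * k) (b + 2 * k) (c + 2 * k)).card = (Phi24 a b c).card := by
  refine Finset.card_bij' (fun x _ => (x.1 - 2 * k, x.2 - 2 * k))
    (fun x _ => (x.1 + 2 * k, x.2 + 2 * k)) ?_ ?_ ?_ ?_
  · intro x hx
    rw [mem_Phi24_iff] at hx ⊢
    simp only
    omega
  · intro x hx
    rw [mem_Phi24_iff] at hx ⊢
    simp only
    omega
  · intro x hx
    rw [mem_Phi24_iff] at hx
    exact Prod.ext (by simp only; omega) (by simp only; omega)
  · intro x _
    simp

theorem card_Phi44_add_two_mul (a b c k : ℕ) :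
    (Phi44 (a + 2 * k) (b + 2 * k) (c + 2 * k)).card = (Phi44 a b c).card := by
  refine Finset.card_bij' (fun x _ => (x.1 - 2 * k, x.2 - 2 * k))
    (fun x _ => (x.1 + 2 * k, x.2 + 2 * k)) ?_ ?_ ?_ ?_
  · intro x hx
    rw [mem_Phi44_iff] at hx ⊢
    simp only
    omega
  · intro x hx
    rw [mem_Phi44_iff] at hx ⊢
    simp only
    omega
  · intro x hx
    rw [mem_Phi44_iff] at hx
    exact Prod.ext (by simp only; omega) (by simp only; omega)
  · intro x _
    simp

end

end SchurU3

/-! ### Assembly of the three assertions -/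

theorem theorem4p13 :
    (∀ (μ : YoungDiagram) (a b k z b' : ℕ) (ε : Fin 2),
      μ.colLen 0 ≤ 3 →
      μ.rowLen 0 = a + 2 * k → μ.rowLen 1 = b + 2 * k → μ.rowLen 2 = (ε : ℕ) + 2 * k →
      a = b + z → b = (ε : ℕ) + b' →
        (SchurU3.trivMult 3 μ SchurU3.H34' : ℚ)
            = (((z : ℚ) + 1) * ((b' : ℚ) + 1) + (SchurU3.kappa ε z b' : ℚ)) / 4 ∧
        (SchurU3.trivMult 3 μ SchurU3.H34 : ℚ)
            = ((b' : ℚ) * (z : ℚ) + (SchurU3.dot (SchurU3.eta ε z b') b' z : ℚ)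
                + (SchurU3.xi ε z b' : ℚ)) / 8) ∧
    (∀ (ε : Fin 2) (z b' : ℕ),
      (SchurU3.omega ε z b' : ℚ)
        = ((SchurU3.dot (SchurU3.alpha ε z b') b' z : ℚ) + (SchurU3.beta ε z b' : ℚ)) / 4) ∧
    (∀ m : ℕ, 1 ≤ m →
      MvPolynomial.C (1 / 2 : ℚ) *
          ((∏ i : Fin m, (1 + MvPolynomial.X i) * (1 + MvPolynomial.X i ^ 2))
            + (∏ i : Fin m, (1 + MvPolynomial.X i) * (1 - MvPolynomial.X i ^ 2)))
        = ∑ μ ∈ SchurU3.partitionsIn (SchurU3.rect m 3),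
            SchurU3.omegaOf μ • SchurU3.schur m μ) := by
  refine ⟨?_, ?_, ?_⟩
  · intro μ a b k z b' ε hμ h₀ h₁ h₂ ha hb
    subst hb ha
    have h₀' : μ.rowLen 0 = z + b' + ((ε : ℕ) + 2 * k) := by omega
    have h₁' : μ.rowLen 1 = b' + ((ε : ℕ) + 2 * k) := by omega
    rw [SchurU3.trivMult_H34' hμ h₀' h₁' h₂, SchurU3.trivMult_H34 hμ h₀' h₁' h₂,
      ← add_assoc, ← add_assoc, SchurU3.card_Phi24_add_two_mul, SchurU3.card_Phi44_add_two_mul]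
    have e₁ := congrArg (Int.cast : ℤ → ℚ) (SchurU3.four_mul_card_Phi24 ε z b')
    have e₂ := congrArg (Int.cast : ℤ → ℚ) (SchurU3.eight_mul_card_Phi44 ε z b')
    push_cast at e₁ e₂
    constructor
    · rw [← e₁]; ring
    · rw [← e₂]; ring
  · intro ε z b'
    have e := congrArg (Int.cast : ℤ → ℚ) (SchurU3.four_mul_omega ε z b')
    push_cast at e
    rw [← e]; ring
  · intro m _
    exact SchurU3.half_sum_prod_eq_sum_omegaOf_smul_schur m
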